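/- **Ordinals.** Let $\Omega=\aleph_1$ and let $\varphi$ be the binary Veblen function. By recursion on $\alpha$, let $B^\Omega(\alpha)$ be the closure of $\{0,\Omega\}$ under $+$, $(\xi,\zeta)\mapsto\varphi\xi\zeta$ and $\xi\mapsto\psi_\Omega(\xi)$ for $\xi<\alpha$, and let $\psi_\Omega(\alpha)$ be the least $\rho<\Omega$ with $\rho\notin B^\Omega(\alpha)$. Let $\varepsilon_{\Omega+1}$ be the least $\zeta>\Omega$ with $\omega^\zeta=\zeta$. The ordinals $\eta$, $\alpha$ of the theorem and the indices of terms belong to the representation system $\mathrm{OT}=B^\Omega(\varepsilon_{\Omega+1})\cap\varepsilon_{\Omega+1}$. For a set $X$ of ordinals let $\mathcal H_\eta(X)=\bigcap\{B^\Omega(\alpha): X\subseteq B^\Omega(\alpha),\ \eta<\alpha\}$. For a map $\mathcal H$ from sets of ordinals to sets of ordinals let $\mathcal H[\delta](X)=\mathcal H(X\cup\{\delta\})$; "$\alpha\in\mathcal H$" means $\alpha\in\mathcal H(\emptyset)$. **Language.** Formulas of $\mathbf{IKP}(\mathcal E)$ are built from atoms $a\in b$ by $\neg,\wedge,\vee,\to$,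 unbounded quantifiers $\forall x,\exists x$, and bounded quantifiers $(\forall x\in a)$, $(\exists x\in a)$, $(\forall x\in{}^ab)$, $(\exists x\in{}^ab)$, the last two ranging over functions from $a$ to $b$. Write $a=b$ for $(\forall x\in a)(x\in b)\wedge(\forall x\in b)(x\in a)$, and $\mathrm{fun}(x,a,b)$ for the bounded formula saying that $x$ is a function from $a$ to $b$ (with pairs $(y,z)=\{\{y,z\},\{y\}\}$). A formula is $\Delta_0^{\mathcal E}$ if it has no unbounded quantifier. The terms of $\mathbf{IRS}^{\mathbb E}_\Omega$ are $\mathbb E_\alpha$ and $a_i^\alpha$ (for $\alpha\in\mathrm{OT}$, $\alpha<\Omega$, $i<\omega$), and $[x\in t\mid F(x,\bar s)]$ for terms $t,\bar s$ and $F$ a $\Delta_0^{\mathcal E}$ formula. Its formulas are those of $\mathbf{IKP}(\mathcal E)$ with terms substituted for all free variables. $\Sigma^{\mathcal E}$ and $\Pi^{\mathcal E}$ are the least classes that contain the $\Delta_0^{\mathcal E}$ formulas, are closed under $\wedge$, $\vee$ and all bounded quantifiers, with $\Sigma^{\mathcal E}$ closed under $\exists x$ and $\Pi^{\mathcal E}$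 under $\forall x$, and such that $\neg C$ and $C\to A$ are $\Sigma^{\mathcal E}$ (resp. $\Pi^{\mathcal E}$) whenever $A$ is $\Sigma^{\mathcal E}$ (resp. $\Pi^{\mathcal E}$) and $C$ is $\Pi^{\mathcal E}$ (resp. $\Sigma^{\mathcal E}$). $A^z$ is $A$ with all unbounded quantifiers restricted to $z$. For $A(\bar s)$ in which exactly the terms $\bar s$ occur and $\bar\beta<\Omega$ the rank $\|A(\bar s)\|_{\bar\beta}$ is given by: $\|s\in t\|_{\beta_1,\beta_2}=\max(\beta_1,\beta_2)$; $\|\neg A\|=\|A\|+1$; $\|A\wedge B\|=\|A\vee B\|=\|A\to B\|=\max(\|A\|,\|B\|)+1$; $\|(Qx\in t)F\|_{\gamma,\bar\beta}=\max(\gamma,\|F(\mathbb E_0)\|_{0,\bar\beta}+2)$; $\|(Qx\in{}^st)F\|_{\gamma,\delta,\bar\beta}=\max(\gamma+\omega,\delta+\omega,\|F(\mathbb E_0)\|_{0,\bar\beta}+2)$; $\|Qx\,F\|_{\bar\beta}=\max(\Omega,\|F(\mathbb E_0)\|_{0,\bar\beta}+2)$. **Axioms.** For finite sets $\Gamma$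 of formulas, terms $p,s,t,\bar p,\bar s,\bar t$, and indices $\alpha,\beta,\gamma,\bar\alpha<\Omega$: (E1) $\Gamma,A\Rightarrow A$ ($A\in\Delta_0^{\mathcal E}$); (E2) $\Gamma\Rightarrow t=t$; (E3) $\Gamma,\bar s=\bar t,B(\bar s)\Rightarrow B(\bar t)$ ($B\in\Delta_0^{\mathcal E}$); (E4) $\Gamma\Rightarrow\mathbb E_\beta\in\mathbb E_\alpha$ ($\beta<\alpha$); (E5) $\Gamma\Rightarrow a_i^\beta\in\mathbb E_\alpha$ ($\beta<\alpha$); (E6) $\Gamma,t\in\mathbb E_\alpha,s\in t\Rightarrow s\in\mathbb E_\alpha$; (E7) $\Gamma,t\in\mathbb E_{\alpha+1},s\in t\Rightarrow s\in\mathbb E_\alpha$; (E8) $\Gamma,s\in t,F(s,\bar p)\Rightarrow s\in[x\in t\mid F(x,\bar p)]$; (E9) $\Gamma,s\in[x\in t\mid F(x,\bar p)]\Rightarrow s\in t\wedge F(s,\bar p)$; (E10) $\Gamma,s\in\mathbb E_\alpha,t\in\mathbb E_\beta,\mathrm{fun}(p,s,t)\Rightarrow p\in\mathbb E_\gamma$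 ($\gamma\ge\max(\alpha,\beta)+2$); (E11) $\Gamma,t\in\mathbb E_\beta,\bar p\in\mathbb E_{\bar\alpha}\Rightarrow[x\in t\mid F(x,\bar p)]\in\mathbb E_\gamma$ ($\gamma\ge\max(\beta,\bar\alpha)$). **Derivability.** $\mathcal H\vdash^\alpha_\rho\Gamma\Rightarrow\Delta$, with $\Gamma$ a finite set of formulas and $\Delta$ a set of at most one formula, always requires $\alpha\in\mathcal H$, and is generated as follows; below "$\alpha_i: S$" stands for the premise $\mathcal H\vdash^{\alpha_i}_\rho S$, and all $\alpha_i<\alpha$. Indices $\beta,\gamma,\delta$ are $<\Omega$ and in $\mathrm{OT}$. - Axioms hold with every $\alpha\in\mathcal H$. - The usual intuitionistic rules $(\wedge L),(\wedge R),(\vee L),(\vee R),(\neg L),(\neg R),(\to L),(\to R)$ and $(\bot)$ (from $\Gamma\Rightarrow{}$ infer $\Gamma\Rightarrow A$), with all premises at height $\alpha_0$. - $(\mathbb E\text{-Lim})$: from $\mathcal H[\delta]\vdash^{\alpha_\delta}_\rho\Gamma,s\in\mathbb E_\delta\Rightarrow\Delta$ for all $\delta<\gamma$ infer $\Gamma,s\in\mathbb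 E_\gamma\Rightarrow\Delta$, if $\gamma\in\mathcal H$ is a limit and all $\alpha_\delta<\alpha$. - $(b\forall L)$ [$(b\exists R)$]: from $\alpha_0:\Gamma,s\in t\to A(s)\Rightarrow\Delta$ [$\alpha_0:\Gamma\Rightarrow s\in t\wedge A(s)$], $\alpha_1:\Gamma\Rightarrow t\in\mathbb E_\beta$, $\alpha_2:\Gamma\Rightarrow s\in\mathbb E_\gamma$ infer $\Gamma,(\forall x\in t)A(x)\Rightarrow\Delta$ [$\Gamma\Rightarrow(\exists x\in t)A(x)$], if $\beta,\gamma\in\mathcal H$, $\gamma<\alpha$, $\gamma\le\beta$. - $(b\forall R)_\infty$ [$(b\exists L)_\infty$]: from $\alpha_0:\Gamma\Rightarrow s\in t\to F(s)$ [$\alpha_0:\Gamma,s\in t\wedge F(s)\Rightarrow\Delta$] for all terms $s$, and $\alpha_1:\Gamma\Rightarrow t\in\mathbb E_\beta$, infer $\Gamma\Rightarrow(\forall x\in t)F(x)$ [$\Gamma,(\exists x\in t)F(x)\Rightarrow\Delta$], if $\beta\in\mathcal H$, $\beta<\alpha$. - $(\mathcal Eb\forall L)$ [$(\mathcal Eb\exists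 R)$]: from $\alpha_0:\Gamma,\mathrm{fun}(p,s,t)\to A(p)\Rightarrow\Delta$ [$\alpha_0:\Gamma\Rightarrow\mathrm{fun}(p,s,t)\wedge A(p)$], $\alpha_1:\Gamma\Rightarrow s\in\mathbb E_\beta$, $\alpha_2:\Gamma\Rightarrow t\in\mathbb E_\gamma$, $\alpha_3:\Gamma\Rightarrow p\in\mathbb E_\delta$ infer $\Gamma,(\forall x\in{}^st)A(x)\Rightarrow\Delta$ [$\Gamma\Rightarrow(\exists x\in{}^st)A(x)$], if $\beta,\gamma,\delta\in\mathcal H$, $\delta<\alpha$, $\delta\le\max(\beta,\gamma)+2$. - $(\mathcal Eb\forall R)_\infty$ [$(\mathcal Eb\exists L)_\infty$]: from $\alpha_0:\Gamma\Rightarrow\mathrm{fun}(p,s,t)\to F(p)$ [$\alpha_0:\Gamma,\mathrm{fun}(p,s,t)\wedge F(p)\Rightarrow\Delta$] for all terms $p$, $\alpha_1:\Gamma\Rightarrow s\in\mathbb E_\beta$, $\alpha_2:\Gamma\Rightarrow t\in\mathbb E_\gamma$ infer $\Gamma\Rightarrow(\forall x\in{}^st)F(x)$ [$\Gamma,(\exists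 x\in{}^st)F(x)\Rightarrow\Delta$], if $\beta,\gamma\in\mathcal H$, $\max(\beta,\gamma)+2\le\alpha$. - $(\forall L)$ [$(\exists R)$]: from $\alpha_0:\Gamma,F(s)\Rightarrow\Delta$ [$\alpha_0:\Gamma\Rightarrow F(s)$] and $\alpha_1:\Gamma\Rightarrow s\in\mathbb E_\beta$ infer $\Gamma,\forall xF(x)\Rightarrow\Delta$ [$\Gamma\Rightarrow\exists xF(x)$], if $\alpha_0+3,\alpha_1+3<\alpha$, $\beta<\alpha$, $\beta\in\mathcal H$. - $(\forall R)_\infty$ [$(\exists L)_\infty$]: from $\mathcal H[\beta]\vdash^{\alpha_\beta}_\rho\Gamma,s\in\mathbb E_\beta\Rightarrow F(s)$ [$\mathcal H[\beta]\vdash^{\alpha_\beta}_\rho\Gamma,s\in\mathbb E_\beta,F(s)\Rightarrow\Delta$] for all terms $s$ and all $\beta<\Omega$ infer $\Gamma\Rightarrow\forall xF(x)$ [$\Gamma,\exists xF(x)\Rightarrow\Delta$], if $\beta<\alpha_\beta+3<\alpha$ for all $\beta$. - $(\Sigma^{\mathcal E}\text{-Ref})$: from $\alpha_0:\Gamma\Rightarrow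 A$ infer $\Gamma\Rightarrow\exists z\,A^z$, if $A$ is $\Sigma^{\mathcal E}$, $\alpha_0+1<\alpha$ and $\Omega<\alpha$. - (Cut): from $\alpha_0:\Gamma,A(\bar s)\Rightarrow\Delta$, $\alpha_1:\Gamma\Rightarrow A(\bar s)$ and $\alpha_2:\Gamma\Rightarrow s_i\in\mathbb E_{\beta_i}$ for each term $s_i$ occurring in $A(\bar s)$, infer $\Gamma\Rightarrow\Delta$, if $\|A(\bar s)\|_{\bar\beta}<\rho$ and $\bar\beta\in\mathcal H$. **Theorem (Cut Elimination II; Collapsing).** Let $\eta,\alpha\in\mathrm{OT}$ with $\eta\in\mathcal H_\eta$, let $\Gamma$ be a finite set of $\Pi^{\mathcal E}$ formulas and let $\Delta$ be a set of at most one $\Sigma^{\mathcal E}$ formula of $\mathbf{IRS}^{\mathbb E}_\Omega$. Put $\hat\alpha=\eta+\omega^\alpha$. Then $\psi_\Omega(\hat\alpha)<\Omega$, and $$\mathcal H_\eta\vdash^{\alpha}_{\Omega+1}\Gamma\Rightarrow\Delta\quad\text{implies}\quad\mathcal H_{\hat\alpha}\vdash^{\psi_\Omega(\hat\alpha)}_{\psi_\Omega(\hat\alpha)}\Gamma\Rightarrow\Delta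 .$$ -/

import Mathlib

open Ordinal

namespace IRSE

/-! ### Ordinals: the sets `B^Ω(α)`, the collapsing function `ψ_Ω`, the operators `H_η` -/

/-- The ordinal `Ω = ℵ₁`. -/
noncomputable def Om : Ordinal.{0} := Ordinal.omega 1

/-- The closure of `{0, Ω}` under `+`, the binary Veblen function `ξ, ζ ↦ φ ξ ζ`, and
the partial function `ξ ↦ f ξ` for `ξ < α`. -/
inductive BClosure (α : Ordinal.{0}) (f : (ξ : Ordinal.{0}) → ξ < α → Ordinal.{0}) :
    Ordinal.{0} → Prop
  | zero : BClosure α f 0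
  | omega : BClosure α f Om
  | add {ξ ζ : Ordinal.{0}} : BClosure α f ξ → BClosure α f ζ → BClosure α f (ξ + ζ)
  | veblen {ξ ζ : Ordinal.{0}} :
      BClosure α f ξ → BClosure α f ζ → BClosure α f (Ordinal.veblen ξ ζ)
  | psi {ξ : Ordinal.{0}} (h : ξ < α) : BClosure α f ξ → BClosure α f (f ξ h)

/-- `ψ_Ω(α)`: the least `ρ < Ω` that is not in `B^Ω(α)`. -/
noncomputable def psi (α : Ordinal.{0}) : Ordinal.{0} :=
  sInf {ρ | ρ < Om ∧ ¬ BClosure α (fun ξ _ => psi ξ) ρ}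
termination_by α

/-- `B^Ω(α)`: the closure of `{0, Ω}` under `+`, `φ` and `ψ_Ω` restricted to arguments `< α`. -/
def B (α : Ordinal.{0}) : Set Ordinal.{0} :=
  {ρ | BClosure α (fun ξ _ => psi ξ) ρ}

/-- `ε_{Ω+1}`: the least `ζ > Ω` with `ω^ζ = ζ`. -/
noncomputable def epsOm : Ordinal.{0} :=
  sInf {ζ | Om < ζ ∧ ω ^ ζ = ζ}

/-- The ordinals of the representation system arising from `B^Ω(ε_{Ω+1})`. -/
def OT : Set Ordinal.{0} := {ξ | ξ ∈ B epsOm ∧ ξ < epsOm}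

/-- The ordinals `< Ω` of the representation system; they index the terms `𝔼_α` and `a_i^α`. -/
abbrev Idx : Type 1 := {β : Ordinal.{0} // β ∈ OT ∧ β < Om}

/-- Maps from sets of ordinals to sets of ordinals. -/
abbrev Op : Type 1 := Set Ordinal.{0} → Set Ordinal.{0}

/-- `H_η(X) = ⋂ {B^Ω(α) : X ⊆ B^Ω(α), η < α}`. -/
def Hop (η : Ordinal.{0}) : Op :=
  fun X => {ξ | ∀ α : Ordinal.{0}, X ⊆ B α → η < α → ξ ∈ B α}

/-- `H[δ](X) = H(X ∪ {δ})`. -/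
def Op.adj (H : Op) (δ : Ordinal.{0}) : Op := fun X => H (X ∪ {δ})

/-! ### Formulas -/

/-- An argument place of a formula: an element of `T` or a bound variable (de Bruijn index). -/
inductive Arg (T : Type 1) : ℕ → Type 1
  | cst {n : ℕ} (t : T) : Arg T n
  | bv {n : ℕ} (i : Fin (n + 1)) : Arg T (n + 1)

/-- Formulas of the language of `IKP(E)`, with elements of `T` in place of free variables and
with `n` loose bound variables. Unbounded quantifiers are available only if `u = true`. -/
inductive Fml (T : Type 1) (u : Bool) : ℕ → Type 1
  | mem {n : ℕ} (s t : Arg T n) : Fml T u n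
  | neg {n : ℕ} (A : Fml T u n) : Fml T u n
  | and {n : ℕ} (A C : Fml T u n) : Fml T u n
  | or {n : ℕ} (A C : Fml T u n) : Fml T u n
  | imp {n : ℕ} (A C : Fml T u n) : Fml T u n
  /-- `(∀ x ∈ t) A(x)` -/
  | ball {n : ℕ} (t : Arg T n) (A : Fml T u (n + 1)) : Fml T u n
  /-- `(∃ x ∈ t) A(x)` -/
  | bex {n : ℕ} (t : Arg T n) (A : Fml T u (n + 1)) : Fml T u n
  /-- `(∀ x ∈ ˢt) A(x)`, where `x` ranges over the functions from `s` to `t` -/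
  | eball {n : ℕ} (s t : Arg T n) (A : Fml T u (n + 1)) : Fml T u n
  /-- `(∃ x ∈ ˢt) A(x)`, where `x` ranges over the functions from `s` to `t` -/
  | ebex {n : ℕ} (s t : Arg T n) (A : Fml T u (n + 1)) : Fml T u n
  | all {n : ℕ} (h : u = true) (A : Fml T u (n + 1)) : Fml T u n
  | ex {n : ℕ} (h : u = true) (A : Fml T u (n + 1)) : Fml T u n

section Syntax0

variable {T : Type 1} {u : Bool}

def Arg.shift : {n : ℕ} → Arg T n → Arg T (n + 1)
  | _, .cst t => .cst t
  | _, .bv i => .bv i.succ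

def Arg.bind {m : ℕ} : {n : ℕ} → (Fin n → Arg T m) → Arg T n → Arg T m
  | _, _, .cst t => .cst t
  | _, σ, .bv i => σ i

/-- Extension of a substitution under one binder. -/
def liftSub {n m : ℕ} (σ : Fin n → Arg T m) : Fin (n + 1) → Arg T (m + 1) :=
  Fin.cons (.bv 0) (fun i => (σ i).shift)

/-- Simultaneous substitution for the loose bound variables. -/
def Fml.subst : {n : ℕ} → Fml T u n → {m : ℕ} → (Fin n → Arg T m) → Fml T u m
  | _, .mem s t, _, σ => .mem (Arg.bind σ s) (Arg.bind σ t)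
  | _, .neg A, _, σ => .neg (A.subst σ)
  | _, .and A C, _, σ => .and (A.subst σ) (C.subst σ)
  | _, .or A C, _, σ => .or (A.subst σ) (C.subst σ)
  | _, .imp A C, _, σ => .imp (A.subst σ) (C.subst σ)
  | _, .ball t A, _, σ => .ball (Arg.bind σ t) (A.subst (liftSub σ))
  | _, .bex t A, _, σ => .bex (Arg.bind σ t) (A.subst (liftSub σ))
  | _, .eball s t A, _, σ => .eball (Arg.bind σ s) (Arg.bind σ t) (A.subst (liftSub σ))
  | _, .ebex s t A, _, σ => .ebex (Arg.bind σ s) (Arg.bind σ t) (A.subst (liftSub σ))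
  | _, .all h A, _, σ => .all h (A.subst (liftSub σ))
  | _, .ex h A, _, σ => .ex h (A.subst (liftSub σ))

/-- Renaming that makes room for one more (innermost) bound variable. -/
def Fml.shift {n : ℕ} (A : Fml T u n) : Fml T u (n + 1) :=
  A.subst (fun i => .bv i.succ)

/-- `A(s)`. -/
def Fml.inst (A : Fml T u 1) (s : T) : Fml T u 0 :=
  A.subst (fun _ => .cst s)

/-- `A(s₁,…,sₙ)`. -/
def Fml.insts {n : ℕ} (A : Fml T u n) (s : Fin n → T) : Fml T u 0 :=
  A.subst (fun i => .cst (s i))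

/-- A formula without unbounded quantifiers, regarded as a formula of the full language. -/
def Fml.incl : {n : ℕ} → Fml T false n → Fml T true n
  | _, .mem s t => .mem s t
  | _, .neg A => .neg A.incl
  | _, .and A C => .and A.incl C.incl
  | _, .or A C => .or A.incl C.incl
  | _, .imp A C => .imp A.incl C.incl
  | _, .ball t A => .ball t A.incl
  | _, .bex t A => .bex t A.incl
  | _, .eball s t A => .eball s t A.incl
  | _, .ebex s t A => .ebex s t A.incl
  | _, .all h _ => nomatch h
  | _, .ex h _ => nomatch h

/-- `Δ₀^E`: no unbounded quantifiers occur. -/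
def Fml.IsDelta : {n : ℕ} → Fml T u n → Prop
  | _, .mem _ _ => True
  | _, .neg A => A.IsDelta
  | _, .and A C => A.IsDelta ∧ C.IsDelta
  | _, .or A C => A.IsDelta ∧ C.IsDelta
  | _, .imp A C => A.IsDelta ∧ C.IsDelta
  | _, .ball _ A => A.IsDelta
  | _, .bex _ A => A.IsDelta
  | _, .eball _ _ A => A.IsDelta
  | _, .ebex _ _ A => A.IsDelta
  | _, .all _ _ => False
  | _, .ex _ _ => False

/-- The classes `Σ^E` (`pol = true`) and `Π^E` (`pol = false`), defined simultaneously. -/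
inductive SigPi : Bool → {n : ℕ} → Fml T true n → Prop
  | delta {pol : Bool} {n : ℕ} {A : Fml T true n} : A.IsDelta → SigPi pol A
  | and {pol : Bool} {n : ℕ} {A C : Fml T true n} :
      SigPi pol A → SigPi pol C → SigPi pol (.and A C)
  | or {pol : Bool} {n : ℕ} {A C : Fml T true n} :
      SigPi pol A → SigPi pol C → SigPi pol (.or A C)
  | ball {pol : Bool} {n : ℕ} {t : Arg T n} {A : Fml T true (n + 1)} :
      SigPi pol A → SigPi pol (.ball t A)
  | bex {pol : Bool} {n : ℕ} {t : Arg T n} {A : Fml T true (n + 1)} :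
      SigPi pol A → SigPi pol (.bex t A)
  | eball {pol : Bool} {n : ℕ} {s t : Arg T n} {A : Fml T true (n + 1)} :
      SigPi pol A → SigPi pol (.eball s t A)
  | ebex {pol : Bool} {n : ℕ} {s t : Arg T n} {A : Fml T true (n + 1)} :
      SigPi pol A → SigPi pol (.ebex s t A)
  | neg {pol : Bool} {n : ℕ} {C : Fml T true n} :
      SigPi (!pol) C → SigPi pol (.neg C)
  | imp {pol : Bool} {n : ℕ} {C A : Fml T true n} :
      SigPi (!pol) C → SigPi pol A → SigPi pol (.imp C A)
  | ex {n : ℕ} {h : true = true} {A : Fml T true (n + 1)} :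
      SigPi true A → SigPi true (.ex h A)
  | all {n : ℕ} {h : true = true} {A : Fml T true (n + 1)} :
      SigPi false A → SigPi false (.all h A)

def Fml.IsSigma {n : ℕ} (A : Fml T true n) : Prop := SigPi true A

def Fml.IsPi {n : ℕ} (A : Fml T true n) : Prop := SigPi false A

/-- `A^z`: every unbounded quantifier of `A` is restricted to `z`. -/
def Fml.rel : {n : ℕ} → Fml T u n → Arg T n → Fml T u n
  | _, .mem s t, _ => .mem s t
  | _, .neg A, z => .neg (A.rel z)
  | _, .and A C, z => .and (A.rel z) (C.rel z)
  | _, .or A C, z => .or (A.rel z) (C.rel z)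
  | _, .imp A C, z => .imp (A.rel z) (C.rel z)
  | _, .ball t A, z => .ball t (A.rel z.shift)
  | _, .bex t A, z => .bex t (A.rel z.shift)
  | _, .eball s t A, z => .eball s t (A.rel z.shift)
  | _, .ebex s t A, z => .ebex s t (A.rel z.shift)
  | _, .all _ A, z => .ball z (A.rel z.shift)
  | _, .ex _ A, z => .bex z (A.rel z.shift)

/-- The elements of `T` that stand at an argument place of `A`. -/
def Fml.params : {n : ℕ} → Fml T u n → Set T
  | _, .mem s t => {p | s = .cst p ∨ t = .cst p}
  | _, .neg A => A.params
  | _, .and A C => A.params ∪ C.params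
  | _, .or A C => A.params ∪ C.params
  | _, .imp A C => A.params ∪ C.params
  | _, .ball t A => {p | t = .cst p} ∪ A.params
  | _, .bex t A => {p | t = .cst p} ∪ A.params
  | _, .eball s t A => {p | s = .cst p ∨ t = .cst p} ∪ A.params
  | _, .ebex s t A => {p | s = .cst p ∨ t = .cst p} ∪ A.params
  | _, .all _ A => A.params
  | _, .ex _ A => A.params

/-- The ordinal attached to an argument place; bound variables count as `0`. -/
def Arg.lev (b : T → Ordinal.{0}) : {n : ℕ} → Arg T n → Ordinal.{0}
  | _, .cst t => b t
  | _, .bv _ => 0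

/-- The rank `‖A(s₁,…,sₙ)‖_{β₁,…,βₙ}`, where `b` assigns to each term `sᵢ` its ordinal `βᵢ`. -/
noncomputable def Fml.rank (b : T → Ordinal.{0}) : {n : ℕ} → Fml T u n → Ordinal.{0}
  | _, .mem s t => max (s.lev b) (t.lev b)
  | _, .neg A => A.rank b + 1
  | _, .and A C => max (A.rank b) (C.rank b) + 1
  | _, .or A C => max (A.rank b) (C.rank b) + 1
  | _, .imp A C => max (A.rank b) (C.rank b) + 1
  | _, .ball t A => max (t.lev b) (A.rank b + 2)
  | _, .bex t A => max (t.lev b) (A.rank b + 2)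
  | _, .eball s t A => max (max (s.lev b + ω) (t.lev b + ω)) (A.rank b + 2)
  | _, .ebex s t A => max (max (s.lev b + ω) (t.lev b + ω)) (A.rank b + 2)
  | _, .all _ A => max Om (A.rank b + 2)
  | _, .ex _ A => max Om (A.rank b + 2)

/-- `a = b`, that is `(∀ x ∈ a) x ∈ b ∧ (∀ x ∈ b) x ∈ a`. -/
def eqF {n : ℕ} (a b : Arg T n) : Fml T u n :=
  .and (.ball a (.mem (.bv 0) b.shift)) (.ball b (.mem (.bv 0) a.shift))

/-- `v = {y, z}`. -/
def isUPair {n : ℕ} (v y z : Arg T n) : Fml T u n :=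
  .and (.and (.mem y v) (.mem z v))
    (.ball v (.or (eqF (.bv 0) y.shift) (eqF (.bv 0) z.shift)))

/-- `w = (y, z)`, with `(y, z) = {{y, z}, {y}}`. -/
def isOPair {n : ℕ} (w y z : Arg T n) : Fml T u n :=
  .and
    (.and (.bex w (isUPair (.bv 0) y.shift z.shift)) (.bex w (isUPair (.bv 0) y.shift y.shift)))
    (.ball w (.or (isUPair (.bv 0) y.shift z.shift) (isUPair (.bv 0) y.shift y.shift)))

/-- `(y, z) ∈ x`. -/
def opairMem {n : ℕ} (y z x : Arg T n) : Fml T u n :=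
  .bex x (isOPair (.bv 0) y.shift z.shift)

/-- `x ⊆ a × b`. -/
def subProd {n : ℕ} (x a b : Arg T n) : Fml T u n :=
  .ball x (.bex a.shift (.bex b.shift.shift (isOPair (.bv 2) (.bv 1) (.bv 0))))

/-- `fun(x, a, b)`: `x` is a function from `a` to `b`. -/
def funF {n : ℕ} (x a b : Arg T n) : Fml T u n :=
  .and (subProd x a b)
    (.and
      (.ball a (.bex b.shift (opairMem (.bv 1) (.bv 0) x.shift.shift)))
      (.ball a (.ball b.shift (.ball b.shift.shift
        (.imp
          (.and (opairMem (.bv 2) (.bv 1) x.shift.shift.shift)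
            (opairMem (.bv 2) (.bv 0) x.shift.shift.shift))
          (eqF (.bv 1) (.bv 0)))))))

end Syntax0

/-! ### The infinitary system -/

/-- Terms: `𝔼_α`, the free variables `a_i^α`, and `[x ∈ t | F(x, s₁, …, sₙ)]` with `F` a
`Δ₀^E` formula. -/
inductive Term : Type 1
  | E (α : Idx) : Term
  | fv (α : Idx) (i : ℕ) : Term
  | sep (t : Term) (F : Fml Term false 1) : Term

/-- The formulas of the infinitary system. -/
abbrev Formula : Type 1 := Fml Term true 0

noncomputable instance : DecidableEq Formula := Classical.decEq _

/-- `s ∈ t`. -/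
def memT (s t : Term) : Formula := .mem (.cst s) (.cst t)

/-- `s = t`. -/
def eqT (s t : Term) : Formula := eqF (.cst s) (.cst t)

/-- `fun(p, s, t)`. -/
def funT (p s t : Term) : Formula := funF (.cst p) (.cst s) (.cst t)

/-- `∃z A^z`. -/
def reflF (A : Formula) : Formula := .ex rfl (A.shift.rel (.bv 0))

/-- The axioms `Γ ⇒ Δ`; `Γ` is a finite set of formulas and `Δ` has at most one formula. -/
inductive IsAxiom : Finset Formula → Option Formula → Prop
  | e1 {Γ : Finset Formula} {A : Formula} : A.IsDelta → A ∈ Γ → IsAxiom Γ (some A)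
  | e2 {Γ : Finset Formula} (t : Term) : IsAxiom Γ (some (eqT t t))
  | e3 {Γ : Finset Formula} {n : ℕ} (A : Fml Term true n) (s t : Fin n → Term) :
      A.IsDelta → (∀ i, eqT (s i) (t i) ∈ Γ) → A.insts s ∈ Γ → IsAxiom Γ (some (A.insts t))
  | e4 {Γ : Finset Formula} (β α : Idx) : β < α → IsAxiom Γ (some (memT (.E β) (.E α)))
  | e5 {Γ : Finset Formula} (β α : Idx) (i : ℕ) :
      β < α → IsAxiom Γ (some (memT (.fv β i) (.E α)))
  | e6 {Γ : Finset Formula} (α : Idx) (s t : Term) :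
      memT t (.E α) ∈ Γ → memT s t ∈ Γ → IsAxiom Γ (some (memT s (.E α)))
  | e7 {Γ : Finset Formula} (α α' : Idx) (s t : Term) : (α' : Ordinal) = α + 1 →
      memT t (.E α') ∈ Γ → memT s t ∈ Γ → IsAxiom Γ (some (memT s (.E α)))
  | e8 {Γ : Finset Formula} (s t : Term) (F : Fml Term false 1) :
      memT s t ∈ Γ → F.incl.inst s ∈ Γ → IsAxiom Γ (some (memT s (.sep t F)))
  | e9 {Γ : Finset Formula} (s t : Term) (F : Fml Term false 1) :
      memT s (.sep t F) ∈ Γ → IsAxiom Γ (some (.and (memT s t) (F.incl.inst s)))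
  | e10 {Γ : Finset Formula} (α β γ : Idx) (p s t : Term) :
      max (α : Ordinal) β + 2 ≤ γ →
      memT s (.E α) ∈ Γ → memT t (.E β) ∈ Γ → funT p s t ∈ Γ →
      IsAxiom Γ (some (memT p (.E γ)))
  | e11 {Γ : Finset Formula} (β γ : Idx) (a : Term → Idx) (t : Term) (F : Fml Term false 1) :
      β ≤ γ → (∀ p ∈ F.params, a p ≤ γ) →
      memT t (.E β) ∈ Γ → (∀ p ∈ F.params, memT p (.E (a p)) ∈ Γ) →
      IsAxiom Γ (some (memT (.sep t F) (.E γ)))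

/-- Operator controlled derivability: `Prov ρ H α Γ Δ` is `H ⊢^α_ρ Γ ⇒ Δ`. -/
inductive Prov (ρ : Ordinal.{0}) :
    Op → Ordinal.{0} → Finset Formula → Option Formula → Prop
  | ax {H : Op} {α : Ordinal.{0}} {Γ : Finset Formula} {Δ : Option Formula}
      (hα : α ∈ H ∅) (h : IsAxiom Γ Δ) : Prov ρ H α Γ Δ
  -- propositional rules
  | andL₁ {H : Op} {α α₀ : Ordinal.{0}} {Γ : Finset Formula} {Δ : Option Formula}
      {A C : Formula} (hα : α ∈ H ∅) (h₀ : α₀ < α)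
      (p : Prov ρ H α₀ (insert A Γ) Δ) : Prov ρ H α (insert (.and A C) Γ) Δ
  | andL₂ {H : Op} {α α₀ : Ordinal.{0}} {Γ : Finset Formula} {Δ : Option Formula}
      {A C : Formula} (hα : α ∈ H ∅) (h₀ : α₀ < α)
      (p : Prov ρ H α₀ (insert C Γ) Δ) : Prov ρ H α (insert (.and A C) Γ) Δ
  | andR {H : Op} {α α₀ : Ordinal.{0}} {Γ : Finset Formula}
      {A C : Formula} (hα : α ∈ H ∅) (h₀ : α₀ < α)
      (p : Prov ρ H α₀ Γ (some A)) (q : Prov ρ H α₀ Γ (some C)) :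
      Prov ρ H α Γ (some (.and A C))
  | orL {H : Op} {α α₀ : Ordinal.{0}} {Γ : Finset Formula} {Δ : Option Formula}
      {A C : Formula} (hα : α ∈ H ∅) (h₀ : α₀ < α)
      (p : Prov ρ H α₀ (insert A Γ) Δ) (q : Prov ρ H α₀ (insert C Γ) Δ) :
      Prov ρ H α (insert (.or A C) Γ) Δ
  | orR₁ {H : Op} {α α₀ : Ordinal.{0}} {Γ : Finset Formula}
      {A C : Formula} (hα : α ∈ H ∅) (h₀ : α₀ < α)
      (p : Prov ρ H α₀ Γ (some A)) : Prov ρ H α Γ (some (.or A C))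
  | orR₂ {H : Op} {α α₀ : Ordinal.{0}} {Γ : Finset Formula}
      {A C : Formula} (hα : α ∈ H ∅) (h₀ : α₀ < α)
      (p : Prov ρ H α₀ Γ (some C)) : Prov ρ H α Γ (some (.or A C))
  | negL {H : Op} {α α₀ : Ordinal.{0}} {Γ : Finset Formula}
      {A : Formula} (hα : α ∈ H ∅) (h₀ : α₀ < α)
      (p : Prov ρ H α₀ Γ (some A)) : Prov ρ H α (insert (.neg A) Γ) none
  | negR {H : Op} {α α₀ : Ordinal.{0}} {Γ : Finset Formula}
      {A : Formula} (hα : α ∈ H ∅) (h₀ : α₀ < α)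
      (p : Prov ρ H α₀ (insert A Γ) none) : Prov ρ H α Γ (some (.neg A))
  | bot {H : Op} {α α₀ : Ordinal.{0}} {Γ : Finset Formula}
      {A : Formula} (hα : α ∈ H ∅) (h₀ : α₀ < α)
      (p : Prov ρ H α₀ Γ none) : Prov ρ H α Γ (some A)
  | impL {H : Op} {α α₀ : Ordinal.{0}} {Γ : Finset Formula} {Δ : Option Formula}
      {A C : Formula} (hα : α ∈ H ∅) (h₀ : α₀ < α)
      (p : Prov ρ H α₀ (insert C Γ) Δ) (q : Prov ρ H α₀ Γ (some A)) :
      Prov ρ H α (insert (.imp A C) Γ) Δ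
  | impR {H : Op} {α α₀ : Ordinal.{0}} {Γ : Finset Formula}
      {A C : Formula} (hα : α ∈ H ∅) (h₀ : α₀ < α)
      (p : Prov ρ H α₀ (insert A Γ) (some C)) : Prov ρ H α Γ (some (.imp A C))
  -- limit rule
  | lim {H : Op} {α : Ordinal.{0}} {Γ : Finset Formula} {Δ : Option Formula}
      {s : Term} {γ : Idx} {a : Idx → Ordinal.{0}} (hα : α ∈ H ∅)
      (hγ : Order.IsSuccLimit (γ : Ordinal.{0})) (hγH : (γ : Ordinal.{0}) ∈ H ∅)
      (ha : ∀ δ : Idx, δ < γ → a δ < α)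
      (p : ∀ δ : Idx, δ < γ → Prov ρ (H.adj δ) (a δ) (insert (memT s (.E δ)) Γ) Δ) :
      Prov ρ H α (insert (memT s (.E γ)) Γ) Δ
  -- bounded quantifiers
  | ballL {H : Op} {α α₀ α₁ α₂ : Ordinal.{0}} {Γ : Finset Formula} {Δ : Option Formula}
      {s t : Term} {A : Fml Term true 1} {β γ : Idx} (hα : α ∈ H ∅)
      (h₀ : α₀ < α) (h₁ : α₁ < α) (h₂ : α₂ < α)
      (hβ : (β : Ordinal.{0}) ∈ H ∅) (hγ : (γ : Ordinal.{0}) ∈ H ∅)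
      (hγα : (γ : Ordinal.{0}) < α) (hγβ : γ ≤ β)
      (p : Prov ρ H α₀ (insert (.imp (memT s t) (A.inst s)) Γ) Δ)
      (q : Prov ρ H α₁ Γ (some (memT t (.E β))))
      (r : Prov ρ H α₂ Γ (some (memT s (.E γ)))) :
      Prov ρ H α (insert (.ball (.cst t) A) Γ) Δ
  | ballR {H : Op} {α α₀ α₁ : Ordinal.{0}} {Γ : Finset Formula}
      {t : Term} {A : Fml Term true 1} {β : Idx} (hα : α ∈ H ∅)
      (h₀ : α₀ < α) (h₁ : α₁ < α)
      (hβ : (β : Ordinal.{0}) ∈ H ∅) (hβα : (β : Ordinal.{0}) < α)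
      (p : ∀ s : Term, Prov ρ H α₀ Γ (some (.imp (memT s t) (A.inst s))))
      (q : Prov ρ H α₁ Γ (some (memT t (.E β)))) :
      Prov ρ H α Γ (some (.ball (.cst t) A))
  | bexL {H : Op} {α α₀ α₁ : Ordinal.{0}} {Γ : Finset Formula} {Δ : Option Formula}
      {t : Term} {A : Fml Term true 1} {β : Idx} (hα : α ∈ H ∅)
      (h₀ : α₀ < α) (h₁ : α₁ < α)
      (hβ : (β : Ordinal.{0}) ∈ H ∅) (hβα : (β : Ordinal.{0}) < α)
      (p : ∀ s : Term, Prov ρ H α₀ (insert (.and (memT s t) (A.inst s)) Γ) Δ)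
      (q : Prov ρ H α₁ Γ (some (memT t (.E β)))) :
      Prov ρ H α (insert (.bex (.cst t) A) Γ) Δ
  | bexR {H : Op} {α α₀ α₁ α₂ : Ordinal.{0}} {Γ : Finset Formula}
      {s t : Term} {A : Fml Term true 1} {β γ : Idx} (hα : α ∈ H ∅)
      (h₀ : α₀ < α) (h₁ : α₁ < α) (h₂ : α₂ < α)
      (hβ : (β : Ordinal.{0}) ∈ H ∅) (hγ : (γ : Ordinal.{0}) ∈ H ∅)
      (hγα : (γ : Ordinal.{0}) < α) (hγβ : γ ≤ β)
      (p : Prov ρ H α₀ Γ (some (.and (memT s t) (A.inst s))))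
      (q : Prov ρ H α₁ Γ (some (memT t (.E β))))
      (r : Prov ρ H α₂ Γ (some (memT s (.E γ)))) :
      Prov ρ H α Γ (some (.bex (.cst t) A))
  -- exponentiation bounded quantifiers
  | eballL {H : Op} {α α₀ α₁ α₂ α₃ : Ordinal.{0}} {Γ : Finset Formula} {Δ : Option Formula}
      {p s t : Term} {A : Fml Term true 1} {β γ δ : Idx} (hα : α ∈ H ∅)
      (h₀ : α₀ < α) (h₁ : α₁ < α) (h₂ : α₂ < α) (h₃ : α₃ < α)
      (hβ : (β : Ordinal.{0}) ∈ H ∅) (hγ : (γ : Ordinal.{0}) ∈ H ∅)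
      (hδ : (δ : Ordinal.{0}) ∈ H ∅)
      (hδα : (δ : Ordinal.{0}) < α) (hδm : (δ : Ordinal.{0}) ≤ max (β : Ordinal.{0}) γ + 2)
      (q₀ : Prov ρ H α₀ (insert (.imp (funT p s t) (A.inst p)) Γ) Δ)
      (q₁ : Prov ρ H α₁ Γ (some (memT s (.E β))))
      (q₂ : Prov ρ H α₂ Γ (some (memT t (.E γ))))
      (q₃ : Prov ρ H α₃ Γ (some (memT p (.E δ)))) :
      Prov ρ H α (insert (.eball (.cst s) (.cst t) A) Γ) Δ
  | eballR {H : Op} {α α₀ α₁ α₂ : Ordinal.{0}} {Γ : Finset Formula}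
      {s t : Term} {A : Fml Term true 1} {β γ : Idx} (hα : α ∈ H ∅)
      (h₀ : α₀ < α) (h₁ : α₁ < α) (h₂ : α₂ < α)
      (hβ : (β : Ordinal.{0}) ∈ H ∅) (hγ : (γ : Ordinal.{0}) ∈ H ∅)
      (hm : max (β : Ordinal.{0}) γ + 2 ≤ α)
      (q₀ : ∀ p : Term, Prov ρ H α₀ Γ (some (.imp (funT p s t) (A.inst p))))
      (q₁ : Prov ρ H α₁ Γ (some (memT s (.E β))))
      (q₂ : Prov ρ H α₂ Γ (some (memT t (.E γ)))) :
      Prov ρ H α Γ (some (.eball (.cst s) (.cst t) A))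
  | ebexL {H : Op} {α α₀ α₁ α₂ : Ordinal.{0}} {Γ : Finset Formula} {Δ : Option Formula}
      {s t : Term} {A : Fml Term true 1} {β γ : Idx} (hα : α ∈ H ∅)
      (h₀ : α₀ < α) (h₁ : α₁ < α) (h₂ : α₂ < α)
      (hβ : (β : Ordinal.{0}) ∈ H ∅) (hγ : (γ : Ordinal.{0}) ∈ H ∅)
      (hm : max (β : Ordinal.{0}) γ + 2 ≤ α)
      (q₀ : ∀ p : Term, Prov ρ H α₀ (insert (.and (funT p s t) (A.inst p)) Γ) Δ)
      (q₁ : Prov ρ H α₁ Γ (some (memT s (.E β))))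
      (q₂ : Prov ρ H α₂ Γ (some (memT t (.E γ)))) :
      Prov ρ H α (insert (.ebex (.cst s) (.cst t) A) Γ) Δ
  | ebexR {H : Op} {α α₀ α₁ α₂ α₃ : Ordinal.{0}} {Γ : Finset Formula}
      {p s t : Term} {A : Fml Term true 1} {β γ δ : Idx} (hα : α ∈ H ∅)
      (h₀ : α₀ < α) (h₁ : α₁ < α) (h₂ : α₂ < α) (h₃ : α₃ < α)
      (hβ : (β : Ordinal.{0}) ∈ H ∅) (hγ : (γ : Ordinal.{0}) ∈ H ∅)
      (hδ : (δ : Ordinal.{0}) ∈ H ∅)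
      (hδα : (δ : Ordinal.{0}) < α) (hδm : (δ : Ordinal.{0}) ≤ max (β : Ordinal.{0}) γ + 2)
      (q₀ : Prov ρ H α₀ Γ (some (.and (funT p s t) (A.inst p))))
      (q₁ : Prov ρ H α₁ Γ (some (memT s (.E β))))
      (q₂ : Prov ρ H α₂ Γ (some (memT t (.E γ))))
      (q₃ : Prov ρ H α₃ Γ (some (memT p (.E δ)))) :
      Prov ρ H α Γ (some (.ebex (.cst s) (.cst t) A))
  -- unbounded quantifiers
  | allL {H : Op} {α α₀ α₁ : Ordinal.{0}} {Γ : Finset Formula} {Δ : Option Formula}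
      {s : Term} {A : Fml Term true 1} {β : Idx} (hα : α ∈ H ∅)
      (h₀ : α₀ + 3 < α) (h₁ : α₁ + 3 < α)
      (hβα : (β : Ordinal.{0}) < α) (hβ : (β : Ordinal.{0}) ∈ H ∅)
      (p : Prov ρ H α₀ (insert (A.inst s) Γ) Δ)
      (q : Prov ρ H α₁ Γ (some (memT s (.E β)))) :
      Prov ρ H α (insert (.all rfl A) Γ) Δ
  | allR {H : Op} {α : Ordinal.{0}} {Γ : Finset Formula}
      {A : Fml Term true 1} {a : Idx → Ordinal.{0}} (hα : α ∈ H ∅)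
      (ha : ∀ β : Idx, (β : Ordinal.{0}) < a β + 3 ∧ a β + 3 < α)
      (p : ∀ (β : Idx) (s : Term),
        Prov ρ (H.adj β) (a β) (insert (memT s (.E β)) Γ) (some (A.inst s))) :
      Prov ρ H α Γ (some (.all rfl A))
  | exL {H : Op} {α : Ordinal.{0}} {Γ : Finset Formula} {Δ : Option Formula}
      {A : Fml Term true 1} {a : Idx → Ordinal.{0}} (hα : α ∈ H ∅)
      (ha : ∀ β : Idx, (β : Ordinal.{0}) < a β + 3 ∧ a β + 3 < α)
      (p : ∀ (β : Idx) (s : Term),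
        Prov ρ (H.adj β) (a β) (insert (memT s (.E β)) (insert (A.inst s) Γ)) Δ) :
      Prov ρ H α (insert (.ex rfl A) Γ) Δ
  | exR {H : Op} {α α₀ α₁ : Ordinal.{0}} {Γ : Finset Formula}
      {s : Term} {A : Fml Term true 1} {β : Idx} (hα : α ∈ H ∅)
      (h₀ : α₀ + 3 < α) (h₁ : α₁ + 3 < α)
      (hβα : (β : Ordinal.{0}) < α) (hβ : (β : Ordinal.{0}) ∈ H ∅)
      (p : Prov ρ H α₀ Γ (some (A.inst s)))
      (q : Prov ρ H α₁ Γ (some (memT s (.E β)))) :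
      Prov ρ H α Γ (some (.ex rfl A))
  -- reflection for `Σ^E` formulas
  | ref {H : Op} {α α₀ : Ordinal.{0}} {Γ : Finset Formula} {A : Formula} (hα : α ∈ H ∅)
      (h₀ : α₀ + 1 < α) (hΩ : Om < α) (hA : A.IsSigma)
      (p : Prov ρ H α₀ Γ (some A)) : Prov ρ H α Γ (some (reflF A))
  -- cut; `b` declares a level for each term of the cut formula
  | cut {H : Op} {α α₀ α₁ α₂ : Ordinal.{0}} {Γ : Finset Formula} {Δ : Option Formula}
      {A : Formula} {b : Term → Idx} (hα : α ∈ H ∅)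
      (h₀ : α₀ < α) (h₁ : α₁ < α) (h₂ : α₂ < α)
      (hr : A.rank (fun s => (b s : Ordinal.{0})) < ρ)
      (hb : ∀ s ∈ A.params, (b s : Ordinal.{0}) ∈ H ∅)
      (p : Prov ρ H α₀ (insert A Γ) Δ)
      (q : Prov ρ H α₁ Γ (some A))
      (r : ∀ s ∈ A.params, Prov ρ H α₂ Γ (some (memT s (.E (b s))))) :
      Prov ρ H α Γ Δ

end IRSE

open IRSE

namespace IRSE

/-! Below Ω the set B^Ω(θ) is exactly the initial segment ψ_Ω(θ) (`mem_B_of_lt_psi`,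
`lt_psi_of_mem_B`), and ψ_Ω(ξ) < ψ_Ω(θ) as soon as ξ < θ and ξ ∈ B^Ω(θ) (`psi_lt_psi`). Every height
or level controlled by H_η lies in B^Ω(η+1). Hence a premise of height α₀ < α collapses to a height
ψ_Ω(η+ω^{α₀}) < ψ_Ω(η+ω^α), and every countable level controlled by H_η is itself below ψ_Ω(η+ω^α).
So most rules can be repeated with collapsed heights. The rules with a premise for every β < Ω never
occur last, because a universal formula is not Σ^E and an existential one is not Π^E.

Two rules need more. For Σ-reflection, collapse the premise to height β < Ω; boundedness
(`Prov.bound`) replaces A by its relativisation to 𝔼_β, and 𝔼_β witnesses the existential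
quantifier.

For a cut of rank at most Ω the cut formula is Δ₀, or one unbounded quantifier in front of a Δ₀
formula (`isDelta_or_of_rank_le`). A Δ₀ cut drops below ψ_Ω(η+ω^α) by itself. In the other case one
premise carries the formula on an admissible side: it collapses to some height β and is bounded by
𝔼_β. The other premise is inverted (`Prov.weaken_inv`) at terms of level β. The resulting instances
are Δ₀, and β is controlled once η is raised by ω to the height of the first premise, so collapsing
applies a second time (`Collapses.two_step`). As ω^α is additively principal, the total stays below
η+ω^α, and a cut with the bounded quantifier finishes.

The induction is on α with η arbitrary: an inverted derivation is not a subderivation, and it is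
collapsed over a larger η. -/

/-! ### The sets B^Ω(α) and the collapsing function -/

theorem B_mono {α β : Ordinal.{0}} (h : α ≤ β) : B α ⊆ B β := by
  intro ρ hρ
  induction hρ with
  | zero => exact .zero
  | omega => exact .omega
  | add _ _ h₁ h₂ => exact .add h₁ h₂
  | veblen _ _ h₁ h₂ => exact .veblen h₁ h₂
  | psi hξ _ ih => exact BClosure.psi (hξ.trans_le h) ih

theorem psi_eq (α : Ordinal.{0}) : psi α = sInf {ρ | ρ < Om ∧ ρ ∉ B α} := by
  rw [psi]; rfl

theorem B_add {α ξ ζ : Ordinal.{0}} (h₁ : ξ ∈ B α) (h₂ : ζ ∈ B α) : ξ + ζ ∈ B α :=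
  BClosure.add h₁ h₂

theorem B_opow {α ξ : Ordinal.{0}} (h : ξ ∈ B α) : ω ^ ξ ∈ B α := by
  rw [← veblen_zero_apply]
  exact BClosure.veblen .zero h

theorem B_psi {α ξ : Ordinal.{0}} (h : ξ < α) (hξ : ξ ∈ B α) : psi ξ ∈ B α :=
  BClosure.psi h hξ

theorem B_one (α : Ordinal.{0}) : (1 : Ordinal.{0}) ∈ B α := by
  simpa using B_opow (α := α) (ξ := 0) .zero

theorem B_natCast (α : Ordinal.{0}) (n : ℕ) : (n : Ordinal.{0}) ∈ B α := by
  induction n with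
  | zero => rw [Nat.cast_zero]; exact BClosure.zero
  | succ n ih => push_cast; exact B_add ih (B_one α)

theorem B_omega0 (α : Ordinal.{0}) : ω ∈ B α := by
  simpa using B_opow (B_one α)

/-- Codes for the elements of `B α`. -/
inductive BCode : Type
  | zero : BCode
  | omega : BCode
  | add : BCode → BCode → BCode
  | veblen : BCode → BCode → BCode
  | psi : BCode → BCode

def BCode.toList : BCode → List ℕ
  | .zero => [0]
  | .omega => [1]
  | .add a b => 2 :: (a.toList ++ b.toList)
  | .veblen a b => 3 :: (a.toList ++ b.toList)
  | .psi a => 4 :: a.toList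

/-- Prefix notation is uniquely readable. Allowing arbitrary tails `l` and `m` is what lets the
induction peel off two consecutive subterms. -/
theorem BCode.append_inj : ∀ (a b : BCode) (l m : List ℕ),
    a.toList ++ l = b.toList ++ m → a = b ∧ l = m := by
  intro a
  induction a with
  | zero => intro b l m h; cases b <;> simp_all [BCode.toList]
  | omega => intro b l m h; cases b <;> simp_all [BCode.toList]
  | add a₁ a₂ h₁ h₂ =>
    intro b l m h
    cases b <;> simp only [BCode.toList, List.cons_append, List.nil_append, List.cons.injEq,
      List.append_assoc] at h <;> try (exact absurd h.1 (by decide))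
    obtain ⟨rfl, h'⟩ := h₁ _ _ _ h.2
    obtain ⟨rfl, h''⟩ := h₂ _ _ _ h'
    exact ⟨rfl, h''⟩
  | veblen a₁ a₂ h₁ h₂ =>
    intro b l m h
    cases b <;> simp only [BCode.toList, List.cons_append, List.nil_append, List.cons.injEq,
      List.append_assoc] at h <;> try (exact absurd h.1 (by decide))
    obtain ⟨rfl, h'⟩ := h₁ _ _ _ h.2
    obtain ⟨rfl, h''⟩ := h₂ _ _ _ h'
    exact ⟨rfl, h''⟩
  | psi a₁ h₁ =>
    intro b l m h
    cases b <;> simp only [BCode.toList, List.cons_append, List.nil_append, List.cons.injEq,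
      List.append_assoc] at h <;> try (exact absurd h.1 (by decide))
    obtain ⟨rfl, h'⟩ := h₁ _ _ _ h.2
    exact ⟨rfl, h'⟩

instance : Countable BCode :=
  Function.Injective.countable (f := BCode.toList) fun a b h =>
    (BCode.append_inj a b [] [] (by simp [h])).1

noncomputable def BCode.val : BCode → Ordinal.{0}
  | .zero => 0
  | .omega => Om
  | .add a b => a.val + b.val
  | .veblen a b => Ordinal.veblen a.val b.val
  | .psi a => IRSE.psi a.val

theorem B_countable (α : Ordinal.{0}) : (B α).Countable := by
  refine (Set.countable_range BCode.val).mono ?_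
  intro ρ hρ
  induction hρ with
  | zero => exact ⟨.zero, rfl⟩
  | omega => exact ⟨.omega, rfl⟩
  | add _ _ h₁ h₂ =>
    obtain ⟨a, rfl⟩ := h₁
    obtain ⟨b, rfl⟩ := h₂
    exact ⟨.add a b, rfl⟩
  | veblen _ _ h₁ h₂ =>
    obtain ⟨a, rfl⟩ := h₁
    obtain ⟨b, rfl⟩ := h₂
    exact ⟨.veblen a b, rfl⟩
  | psi _ _ h =>
    obtain ⟨a, rfl⟩ := h
    exact ⟨.psi a, rfl⟩

/-- Otherwise the uncountable segment below ℵ₁ would be contained in the countable set B^Ω(α). This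
makes the infimum defining ψ_Ω a genuine minimum. -/
theorem exists_lt_Om_notMem (α : Ordinal.{0}) : {ρ | ρ < Om ∧ ρ ∉ B α}.Nonempty := by
  by_contra h
  rw [Set.not_nonempty_iff_eq_empty] at h
  have hsub : Set.Iio Om ⊆ B α := by
    intro ρ hρ
    by_contra hn
    have : ρ ∈ {ρ | ρ < Om ∧ ρ ∉ B α} := ⟨hρ, hn⟩
    simp [h] at this
  have h₁ := ((B_countable α).mono hsub).le_aleph0
  rw [Cardinal.mk_Iio_ordinal, Om, card_omega, Cardinal.lift_le_aleph0] at h₁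
  exact absurd h₁ (not_le.2 Cardinal.aleph0_lt_aleph_one)

theorem psi_lt_Om (α : Ordinal.{0}) : psi α < Om := by
  rw [psi_eq]; exact (csInf_mem (exists_lt_Om_notMem α)).1

theorem psi_notMem (α : Ordinal.{0}) : psi α ∉ B α := by
  rw [psi_eq]; exact (csInf_mem (exists_lt_Om_notMem α)).2

theorem mem_B_of_lt_psi {α ξ : Ordinal.{0}} (h : ξ < psi α) : ξ ∈ B α := by
  by_contra hn
  have hΩ := h.trans (psi_lt_Om α)
  rw [psi_eq] at h
  exact notMem_of_lt_csInf' h ⟨hΩ, hn⟩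

theorem psi_mono {α β : Ordinal.{0}} (h : α ≤ β) : psi α ≤ psi β := by
  by_contra hn
  exact psi_notMem β (B_mono h (mem_B_of_lt_psi (not_le.1 hn)))

/-- Monotonicity alone gives ≤. In case of equality, closure of B^Ω(α) under ψ_Ω at ξ would put
ψ_Ω(α) into B^Ω(α). -/
theorem psi_lt_psi {α ξ : Ordinal.{0}} (h : ξ < α) (hξ : ξ ∈ B α) : psi ξ < psi α := by
  refine lt_of_le_of_ne (psi_mono h.le) fun he => psi_notMem α ?_
  rw [← he]; exact B_psi h hξ

/-- Ordinals below ψ_Ω(α) lie in B^Ω(α), hence so do their sums, and none of these sums is ψ_Ω(α).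
An ordinal that is not a sum of two smaller ones is additively principal. -/
theorem isPrincipal_add_psi (α : Ordinal.{0}) : IsPrincipal (· + ·) (psi α) := by
  rw [isPrincipal_add_iff_add_lt_ne_self]
  intro b hb c hc h
  exact psi_notMem α (h ▸ B_add (mem_B_of_lt_psi hb) (mem_B_of_lt_psi hc))

theorem psi_add_lt {α ξ ζ : Ordinal.{0}} (h₁ : ξ < psi α) (h₂ : ζ < psi α) : ξ + ζ < psi α :=
  isPrincipal_add_psi α h₁ h₂

theorem psi_pos (α : Ordinal.{0}) : 0 < psi α := by
  rw [pos_iff_ne_zero]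
  intro h
  exact psi_notMem α (h ▸ .zero)

/-- Closure of B^Ω(α) only shows that the value differs from ψ_Ω(α), not that it is smaller. The
proof shows that ψ_Ω(α) is a fixed point of ξ ↦ φξ0, by taking its Veblen normal form. -/
theorem psi_veblen_lt {α ξ ζ : Ordinal.{0}} (h₁ : ξ < psi α) (h₂ : ζ < psi α) :
    veblen ξ ζ < psi α := by
  obtain h0 | ⟨x, hx⟩ := isPrincipal_add_iff_zero_or_omega0_opow.1 (isPrincipal_add_psi α)
  · exact absurd h0 (psi_pos α).ne'
  have hx' : ω ^ x = psi α := hx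
  have h2 : invVeblen₂ x < psi α := hx' ▸ invVeblen₂_lt x
  have hle : x ≤ psi α := hx' ▸ right_le_opow x one_lt_omega0
  -- If both components of the normal form were below ψ_Ω(α), they would lie in B^Ω(α), and so would
  -- ψ_Ω(α).
  have h1 : psi α ≤ invVeblen₁ x := by
    by_contra hn
    refine psi_notMem α ?_
    rw [← hx', ← veblen_invVeblen₁_invVeblen₂]
    exact BClosure.veblen (mem_B_of_lt_psi (not_le.1 hn)) (mem_B_of_lt_psi h2)
  have hxe : x = psi α := hle.antisymm (h1.trans (invVeblen₁_le x))
  rw [hxe] at h1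
  -- The exponent equals ψ_Ω(α) and is its own first Veblen component, so it is 0 or a Γ-number.
  have hfix : veblen (psi α) 0 = psi α := by
    obtain h | h := invVeblen₁_eq_iff.1 ((invVeblen₁_le _).antisymm h1)
    · exact absurd h (psi_pos α).ne'
    · exact mem_range_gamma.1 h
  rw [← hfix, veblen_lt_veblen_iff]
  exact Or.inr (Or.inl ⟨h₁, hfix.symm ▸ h₂⟩)

/-- Sums and Veblen values dominate their arguments, so the arguments of a countable value are
countable and the induction hypotheses apply. In the ψ_Ω case the argument may be uncountable, and
`psi_lt_psi` is used instead. -/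
theorem lt_psi_of_mem_B {α ξ : Ordinal.{0}} (h : ξ ∈ B α) (hΩ : ξ < Om) : ξ < psi α := by
  induction h with
  | zero => exact psi_pos α
  | omega => exact absurd hΩ (lt_irrefl _)
  | add _ _ h₁ h₂ =>
    exact psi_add_lt (h₁ (le_self_add.trans_lt hΩ)) (h₂ (le_add_self.trans_lt hΩ))
  | veblen _ _ h₁ h₂ =>
    exact psi_veblen_lt (h₁ ((left_le_veblen _ _).trans_lt hΩ))
      (h₂ ((right_le_veblen _ _).trans_lt hΩ))
  | psi hξ h _ => exact psi_lt_psi hξ h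

theorem natCast_lt_psi (α : Ordinal.{0}) (n : ℕ) : (n : Ordinal.{0}) < psi α :=
  lt_psi_of_mem_B (B_natCast α n) ((natCast_lt_omega0 n).trans_le (omega0_le_omega 1))

theorem omega0_lt_psi (α : Ordinal.{0}) : ω < psi α :=
  lt_psi_of_mem_B (B_omega0 α) (by
    rw [Om, ← omega_zero]; exact omega_lt_omega.2 zero_lt_one)

theorem psi_add_natCast_lt {α ξ : Ordinal.{0}} (h : ξ < psi α) (n : ℕ) : ξ + n < psi α :=
  psi_add_lt h (natCast_lt_psi α n)

/-! ### Operators with empty argument and closure of OT -/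

/-- The sets B^Ω(α) increase with α, so the intersection over all α > η is attained at η + 1. -/
theorem mem_Hop_empty {η ξ : Ordinal.{0}} : ξ ∈ Hop η ∅ ↔ ξ ∈ B (η + 1) := by
  constructor
  · intro h; exact h _ (Set.empty_subset _) (lt_add_one η)
  · intro h α _ hα; exact B_mono (by simpa using Order.succ_le_of_lt hα) h

theorem epsOm_nonempty : {ζ : Ordinal.{0} | Om < ζ ∧ ω ^ ζ = ζ}.Nonempty := by
  refine ⟨epsilon (Om + 1), ?_, omega0_opow_epsilon _⟩
  exact (lt_add_one Om).trans_le (right_le_veblen _ _)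

theorem Om_lt_epsOm : Om < epsOm := (csInf_mem epsOm_nonempty).1

theorem opow_epsOm : ω ^ epsOm = epsOm := (csInf_mem epsOm_nonempty).2

theorem opow_lt_epsOm {α : Ordinal.{0}} (h : α < epsOm) : ω ^ α < epsOm := by
  conv_rhs => rw [← opow_epsOm]
  exact (opow_lt_opow_iff_right one_lt_omega0).2 h

theorem add_lt_epsOm {α β : Ordinal.{0}} (h₁ : α < epsOm) (h₂ : β < epsOm) :
    α + β < epsOm := by
  have := isPrincipal_add_omega0_opow epsOm
  rw [opow_epsOm] at this
  exact this h₁ h₂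

theorem natCast_lt_epsOm (n : ℕ) : (n : Ordinal.{0}) < epsOm :=
  ((natCast_lt_omega0 n).trans_le (omega0_le_omega 1)).trans Om_lt_epsOm

theorem psi_mem_OT {ξ : Ordinal.{0}} (h : ξ ∈ OT) : psi ξ ∈ OT :=
  ⟨B_psi h.2 h.1, (psi_lt_Om ξ).trans Om_lt_epsOm⟩

theorem add_mem_OT {ξ ζ : Ordinal.{0}} (h₁ : ξ ∈ OT) (h₂ : ζ ∈ OT) : ξ + ζ ∈ OT :=
  ⟨B_add h₁.1 h₂.1, add_lt_epsOm h₁.2 h₂.2⟩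

theorem opow_mem_OT {ξ : Ordinal.{0}} (h : ξ ∈ OT) : ω ^ ξ ∈ OT :=
  ⟨B_opow h.1, opow_lt_epsOm h.2⟩

theorem natCast_mem_OT (n : ℕ) : (n : Ordinal.{0}) ∈ OT :=
  ⟨B_natCast _ n, natCast_lt_epsOm n⟩

/-! ### Substitution, relativisation, formula classes and ranks -/

section

variable {T : Type 1} {u : Bool}

theorem Arg.bind_liftSub_shift {n m : ℕ} (σ : Fin n → Arg T m) (s : Arg T n) :
    Arg.bind (liftSub σ) s.shift = (Arg.bind σ s).shift := by
  cases s <;> rfl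

theorem Arg.bind_bind {n m k : ℕ} (σ : Fin n → Arg T m) (τ : Fin m → Arg T k) (s : Arg T n) :
    Arg.bind τ (Arg.bind σ s) = Arg.bind (fun i => Arg.bind τ (σ i)) s := by
  cases s <;> rfl

theorem liftSub_comp {n m k : ℕ} (σ : Fin n → Arg T m) (τ : Fin m → Arg T k) :
    (fun i => Arg.bind (liftSub τ) (liftSub σ i)) = liftSub (fun i => Arg.bind τ (σ i)) := by
  funext i
  refine Fin.cases rfl (fun j => ?_) i
  exact Arg.bind_liftSub_shift τ (σ j)

theorem Fml.subst_subst {n : ℕ} (A : Fml T u n) : ∀ {m k : ℕ} (σ : Fin n → Arg T m)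
    (τ : Fin m → Arg T k), (A.subst σ).subst τ = A.subst (fun i => Arg.bind τ (σ i)) := by
  induction A <;> intro m k σ τ <;>
    simp_all [Fml.subst, Arg.bind_bind, liftSub_comp]

theorem Fml.rel_subst {n : ℕ} (A : Fml T u n) : ∀ {m : ℕ} (σ : Fin n → Arg T m) (z : Arg T n),
    (A.rel z).subst σ = (A.subst σ).rel (Arg.bind σ z) := by
  induction A <;> intro m σ z <;>
    simp_all [Fml.subst, Fml.rel, Arg.bind_liftSub_shift]

/-- The identity substitution. -/
def idSub : (n : ℕ) → Fin n → Arg T n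
  | 0 => fun i => i.elim0
  | _ + 1 => fun i => .bv i

theorem Arg.bind_idSub {n : ℕ} (s : Arg T n) : Arg.bind (idSub n) s = s := by
  cases s <;> rfl

theorem liftSub_idSub (n : ℕ) : liftSub (idSub n : Fin n → Arg T n) = idSub (n + 1) := by
  funext i
  refine Fin.cases rfl (fun j => ?_) i
  cases n with
  | zero => exact j.elim0
  | succ n => rfl

theorem Fml.subst_idSub {n : ℕ} (A : Fml T u n) : A.subst (idSub n) = A := by
  induction A <;> simp_all [Fml.subst, Arg.bind_idSub, liftSub_idSub]

theorem Fml.subst_closed (A : Fml T u 0) (σ : Fin 0 → Arg T 0) : A.subst σ = A := by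
  rw [Subsingleton.elim σ (idSub 0), A.subst_idSub]

theorem Fml.rel_inst (A : Fml T u 1) (s z : T) :
    (A.rel (.cst z)).inst s = (A.inst s).rel (.cst z) :=
  A.rel_subst _ _

/-- Since A is closed, making room for z and then instantiating leaves A unchanged, and only the
relativising argument is replaced. It identifies the instance needed when reflection is turned into
an existential introduction. -/
theorem Fml.shift_rel_inst (A : Fml T u 0) (s : T) :
    (A.shift.rel (.bv 0)).inst s = A.rel (.cst s) := by
  rw [Fml.inst, Fml.rel_subst, Fml.shift, Fml.subst_subst, Fml.subst_closed]
  rfl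

theorem Fml.isDelta_subst {n : ℕ} (A : Fml T u n) : ∀ {m : ℕ} (σ : Fin n → Arg T m),
    (A.subst σ).IsDelta ↔ A.IsDelta := by
  induction A <;> intro m σ <;> simp_all [Fml.subst, Fml.IsDelta]

theorem Fml.isDelta_incl : ∀ {n : ℕ} (A : Fml T false n), A.incl.IsDelta
  | _, .mem _ _ => trivial
  | _, .neg A => A.isDelta_incl
  | _, .and A C => ⟨A.isDelta_incl, C.isDelta_incl⟩
  | _, .or A C => ⟨A.isDelta_incl, C.isDelta_incl⟩
  | _, .imp A C => ⟨A.isDelta_incl, C.isDelta_incl⟩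
  | _, .ball _ A => A.isDelta_incl
  | _, .bex _ A => A.isDelta_incl
  | _, .eball _ _ A => A.isDelta_incl
  | _, .ebex _ _ A => A.isDelta_incl
  | _, .all h _ => nomatch h
  | _, .ex h _ => nomatch h

theorem Fml.IsDelta.rel_eq {n : ℕ} {A : Fml T u n} : ∀ (_ : A.IsDelta) (z : Arg T n),
    A.rel z = A := by
  induction A <;> intro h z <;> simp_all [Fml.IsDelta, Fml.rel]

theorem SigPi.subst {pol : Bool} {n : ℕ} {A : Fml T true n} (h : SigPi pol A) :
    ∀ {m : ℕ} (σ : Fin n → Arg T m), SigPi pol (A.subst σ) := by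
  induction h with
  | delta h => intro m σ; exact .delta ((Fml.isDelta_subst _ σ).2 h)
  | and _ _ h₁ h₂ => intro m σ; exact .and (h₁ σ) (h₂ σ)
  | or _ _ h₁ h₂ => intro m σ; exact .or (h₁ σ) (h₂ σ)
  | ball _ h => intro m σ; exact .ball (h _)
  | bex _ h => intro m σ; exact .bex (h _)
  | eball _ h => intro m σ; exact .eball (h _)
  | ebex _ h => intro m σ; exact .ebex (h _)
  | neg _ h => intro m σ; exact .neg (h σ)
  | imp _ _ h₁ h₂ => intro m σ; exact .imp (h₁ σ) (h₂ σ)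
  | ex _ h => intro m σ; exact .ex (h _)
  | all _ h => intro m σ; exact .all (h _)

theorem SigPi.inst {pol : Bool} {A : Fml T true 1} (h : SigPi pol A) (s : T) :
    SigPi pol (A.inst s) := h.subst _

theorem sigPi_and {pol : Bool} {n : ℕ} {A C : Fml T true n} :
    SigPi pol (.and A C) ↔ SigPi pol A ∧ SigPi pol C := by
  constructor
  · rintro (h | ⟨h₁, h₂⟩)
    · exact ⟨.delta h.1, .delta h.2⟩
    · exact ⟨h₁, h₂⟩
  · rintro ⟨h₁, h₂⟩; exact .and h₁ h₂

theorem sigPi_or {pol : Bool} {n : ℕ} {A C : Fml T true n} :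
    SigPi pol (.or A C) ↔ SigPi pol A ∧ SigPi pol C := by
  constructor
  · intro h
    cases h with
    | delta h => exact ⟨.delta h.1, .delta h.2⟩
    | or h₁ h₂ => exact ⟨h₁, h₂⟩
  · rintro ⟨h₁, h₂⟩; exact .or h₁ h₂

theorem sigPi_imp {pol : Bool} {n : ℕ} {C A : Fml T true n} :
    SigPi pol (.imp C A) ↔ SigPi (!pol) C ∧ SigPi pol A := by
  constructor
  · intro h
    cases h with
    | delta h => exact ⟨.delta h.1, .delta h.2⟩
    | imp h₁ h₂ => exact ⟨h₁, h₂⟩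
  · rintro ⟨h₁, h₂⟩; exact .imp h₁ h₂

theorem sigPi_neg {pol : Bool} {n : ℕ} {C : Fml T true n} :
    SigPi pol (.neg C) ↔ SigPi (!pol) C := by
  constructor
  · intro h
    cases h with
    | delta h => exact .delta h
    | neg h => exact h
  · exact .neg

theorem sigPi_ball {pol : Bool} {n : ℕ} {t : Arg T n} {A : Fml T true (n + 1)} :
    SigPi pol (.ball t A) ↔ SigPi pol A := by
  constructor
  · intro h
    cases h with
    | delta h => exact .delta h
    | ball h => exact h
  · exact .ball

theorem sigPi_bex {pol : Bool} {n : ℕ} {t : Arg T n} {A : Fml T true (n + 1)} :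
    SigPi pol (.bex t A) ↔ SigPi pol A := by
  constructor
  · intro h
    cases h with
    | delta h => exact .delta h
    | bex h => exact h
  · exact .bex

theorem sigPi_eball {pol : Bool} {n : ℕ} {s t : Arg T n} {A : Fml T true (n + 1)} :
    SigPi pol (.eball s t A) ↔ SigPi pol A := by
  constructor
  · intro h
    cases h with
    | delta h => exact .delta h
    | eball h => exact h
  · exact .eball

theorem sigPi_ebex {pol : Bool} {n : ℕ} {s t : Arg T n} {A : Fml T true (n + 1)} :
    SigPi pol (.ebex s t A) ↔ SigPi pol A := by
  constructor
  · intro h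
    cases h with
    | delta h => exact .delta h
    | ebex h => exact h
  · exact .ebex

theorem sigPi_all {pol : Bool} {n : ℕ} {h : true = true} {A : Fml T true (n + 1)} :
    SigPi pol (.all h A) ↔ pol = false ∧ SigPi pol A := by
  constructor
  · intro h
    cases h with
    | delta h => exact h.elim
    | all h => exact ⟨rfl, h⟩
  · rintro ⟨rfl, h⟩; exact .all h

theorem sigPi_ex {pol : Bool} {n : ℕ} {h : true = true} {A : Fml T true (n + 1)} :
    SigPi pol (.ex h A) ↔ pol = true ∧ SigPi pol A := by
  constructor
  · intro h
    cases h with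
    | delta h => exact h.elim
    | ex h => exact ⟨rfl, h⟩
  · rintro ⟨rfl, h⟩; exact .ex h

theorem isDelta_eqF {n : ℕ} (a b : Arg T n) : (eqF a b : Fml T u n).IsDelta := by
  simp [eqF, Fml.IsDelta]

theorem isDelta_isUPair {n : ℕ} (v y z : Arg T n) : (isUPair v y z : Fml T u n).IsDelta := by
  simp [isUPair, Fml.IsDelta, isDelta_eqF]

theorem isDelta_isOPair {n : ℕ} (w y z : Arg T n) : (isOPair w y z : Fml T u n).IsDelta := by
  simp [isOPair, Fml.IsDelta, isDelta_isUPair]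

theorem isDelta_opairMem {n : ℕ} (y z x : Arg T n) : (opairMem y z x : Fml T u n).IsDelta := by
  simp [opairMem, Fml.IsDelta, isDelta_isOPair]

theorem isDelta_funF {n : ℕ} (x a b : Arg T n) : (funF x a b : Fml T u n).IsDelta := by
  simp [funF, subProd, Fml.IsDelta, isDelta_isOPair, isDelta_opairMem, isDelta_eqF]

theorem Arg.lev_lt {b : T → Ordinal.{0}} {κ : Ordinal.{0}} (h0 : 0 < κ) {n : ℕ} {s : Arg T n}
    (h : ∀ p, s = .cst p → b p < κ) : s.lev b < κ := by
  cases s with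
  | cst t => exact h t rfl
  | bv i => exact h0

/-- The rank of a Δ₀ formula arises from levels by maxima, finite increments and + ω, with no
contribution of Ω, and κ absorbs all of these. With κ = ψ_Ω(θ) it makes Δ₀ cuts admissible after
collapsing. -/
theorem Fml.IsDelta.rank_lt {b : T → Ordinal.{0}} {κ : Ordinal.{0}} (hω : ω < κ)
    (hκ : IsPrincipal (· + ·) κ) {n : ℕ} {A : Fml T u n} (hA : A.IsDelta)
    (hb : ∀ p ∈ A.params, b p < κ) : A.rank b < κ := by
  have h0 : 0 < κ := omega0_pos.trans hω
  have h1 : (1 : Ordinal.{0}) < κ := one_lt_omega0.trans hω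
  have h2 : (2 : Ordinal.{0}) < κ := (natCast_lt_omega0 2).trans hω
  have hs : ∀ {x y : Ordinal.{0}}, x < κ → y < κ → x + y < κ := fun hx hy => hκ hx hy
  induction A with
  | mem s t =>
    exact max_lt (Arg.lev_lt h0 fun p hp => hb p (Or.inl hp))
      (Arg.lev_lt h0 fun p hp => hb p (Or.inr hp))
  | neg A ih => exact hs (ih hA hb) h1
  | and A C ih₁ ih₂ | or A C ih₁ ih₂ | imp A C ih₁ ih₂ =>
    exact hs (max_lt (ih₁ hA.1 fun p hp => hb p (Or.inl hp))
      (ih₂ hA.2 fun p hp => hb p (Or.inr hp))) h1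
  | ball t A ih | bex t A ih =>
    exact max_lt (Arg.lev_lt h0 fun p hp => hb p (Or.inl hp))
      (hs (ih hA fun p hp => hb p (Or.inr hp)) h2)
  | eball s t A ih | ebex s t A ih =>
    exact max_lt (max_lt
      (hs (Arg.lev_lt h0 fun p hp => hb p (Or.inl (Or.inl hp))) hω)
      (hs (Arg.lev_lt h0 fun p hp => hb p (Or.inl (Or.inr hp))) hω))
      (hs (ih hA fun p hp => hb p (Or.inr hp)) h2)
  | all h A ih | ex h A ih => exact hA.elim

/-- An unbounded quantifier contributes at least Ω, and the rank of a formula bounds those of its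
parts. -/
theorem Fml.isDelta_of_rank_lt {b : T → Ordinal.{0}} {n : ℕ} {A : Fml T u n}
    (h : A.rank b < Om) : A.IsDelta := by
  induction A with
  | mem s t => trivial
  | neg A ih => exact ih (le_self_add.trans_lt h)
  | and A C ih₁ ih₂ | or A C ih₁ ih₂ | imp A C ih₁ ih₂ =>
    exact ⟨ih₁ (((le_max_left _ _).trans le_self_add).trans_lt h),
      ih₂ (((le_max_right _ _).trans le_self_add).trans_lt h)⟩
  | ball t A ih | bex t A ih | eball s t A ih | ebex s t A ih =>
    exact ih ((le_self_add.trans (le_max_right _ _)).trans_lt h)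
  | all h' A ih | ex h' A ih => exact absurd h (not_lt.2 (le_max_left _ _))

end

theorem isSuccLimit_Om : Order.IsSuccLimit Om := Cardinal.isSuccLimit_omega 1

theorem add_two_le_Om {x : Ordinal.{0}} (h : x + 2 ≤ Om) : x < Om :=
  (lt_add_of_pos_right x two_pos).trans_le h

theorem lt_Om_of_add_one_le {x : Ordinal.{0}} (h : x + 1 ≤ Om) : x + 1 < Om :=
  isSuccLimit_Om.add_one_lt (Order.add_one_le_iff.1 h)

/-- A formula of rank at most `Ω` is `Δ₀`, or an unbounded quantifier in front of a `Δ₀`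
formula. -/
theorem isDelta_or_of_rank_le {b : Term → Idx} {A : Formula}
    (h : A.rank (fun s => (b s : Ordinal.{0})) ≤ Om) :
    A.IsDelta ∨ (∃ F : Fml Term true 1, F.IsDelta ∧ A = .all rfl F) ∨
      ∃ F : Fml Term true 1, F.IsDelta ∧ A = .ex rfl F := by
  obtain h | h := h.lt_or_eq
  · exact Or.inl (Fml.isDelta_of_rank_lt h)
  have h' := h.le
  have hq : ∀ {x : Ordinal.{0}} {F : Fml Term true 1},
      max x (F.rank (fun s => (b s : Ordinal.{0})) + 2) ≤ Om → F.IsDelta := fun h =>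
    Fml.isDelta_of_rank_lt (add_two_le_Om ((le_max_right _ _).trans h))
  cases A with
  | mem s t => exact Or.inl trivial
  -- These connectives give a successor rank, which cannot equal the limit Ω.
  | neg A | and A C | or A C | imp A C =>
    simp only [Fml.rank] at h h'
    exact absurd h (lt_Om_of_add_one_le h').ne
  | ball t A | bex t A | eball s t A | ebex s t A =>
    simp only [Fml.rank] at h'
    exact Or.inl (hq h')
  | all _ A =>
    simp only [Fml.rank] at h'
    exact Or.inr (Or.inl ⟨A, hq h', rfl⟩)
  | ex _ A =>
    simp only [Fml.rank] at h'
    exact Or.inr (Or.inr ⟨A, hq h', rfl⟩)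

/-! ### Weakening and inversion -/

theorem IsAxiom.isDelta {Γ : Finset Formula} {Δ : Option Formula} (h : IsAxiom Γ Δ) :
    ∃ A : Formula, Δ = some A ∧ A.IsDelta := by
  cases h with
  | e1 h _ => exact ⟨_, rfl, h⟩
  | e2 t => exact ⟨_, rfl, isDelta_eqF _ _⟩
  | e3 A s t h _ _ => exact ⟨_, rfl, (Fml.isDelta_subst _ _).2 h⟩
  | e9 s t F _ => exact ⟨_, rfl, trivial, (Fml.isDelta_subst _ _).2 (Fml.isDelta_incl F)⟩
  | _ => exact ⟨_, rfl, trivial⟩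

/-- Every formula that an axiom requires in its antecedent is Δ₀. So axioms survive both inversion,
which removes existential formulas, and boundedness, which changes only formulas with unbounded
quantifiers. -/
theorem IsAxiom.mono {Γ Γ' : Finset Formula} {Δ : Option Formula} (h : IsAxiom Γ Δ)
    (hΓ : ∀ A ∈ Γ, A.IsDelta → A ∈ Γ') : IsAxiom Γ' Δ := by
  have hm : ∀ s t, memT s t ∈ Γ → memT s t ∈ Γ' := fun s t h => hΓ _ h trivial
  cases h with
  | e1 h h' => exact .e1 h (hΓ _ h' h)
  | e2 t => exact .e2 t
  | e3 A s t h h₁ h₂ =>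
    exact .e3 A s t h (fun i => hΓ _ (h₁ i) (isDelta_eqF _ _))
      (hΓ _ h₂ ((Fml.isDelta_subst _ _).2 h))
  | e4 β α h => exact .e4 β α h
  | e5 β α i h => exact .e5 β α i h
  | e6 α s t h₁ h₂ => exact .e6 α s t (hm _ _ h₁) (hm _ _ h₂)
  | e7 α α' s t h h₁ h₂ => exact .e7 α α' s t h (hm _ _ h₁) (hm _ _ h₂)
  | e8 s t F h₁ h₂ =>
    exact .e8 s t F (hm _ _ h₁) (hΓ _ h₂ ((Fml.isDelta_subst _ _).2 (Fml.isDelta_incl F)))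
  | e9 s t F h => exact .e9 s t F (hm _ _ h)
  | e10 α β γ p s t h h₁ h₂ h₃ =>
    exact .e10 α β γ p s t h (hm _ _ h₁) (hm _ _ h₂) (hΓ _ h₃ (isDelta_funF _ _ _))
  | e11 β γ a t F h h' h₁ h₂ =>
    exact .e11 β γ a t F h h' (hm _ _ h₁) fun p hp => hm _ _ (h₂ p hp)

theorem Prov.height_mem {ρ α : Ordinal.{0}} {H : Op} {Γ : Finset Formula} {Δ : Option Formula}
    (h : Prov ρ H α Γ Δ) : α ∈ H ∅ := by
  cases h <;> assumption

/-- Antecedents are sets, so contraction is implicit: the left rules produce `insert P Γ`, and this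
discards the extra copy when P is already present. -/
theorem Prov.of_mem {ρ α : Ordinal.{0}} {H : Op} {Γ : Finset Formula} {Δ : Option Formula}
    {P : Formula} (hP : P ∈ Γ) (h : Prov ρ H α (insert P Γ) Δ) : Prov ρ H α Γ Δ := by
  rwa [Finset.insert_eq_of_mem hP] at h

/-- `A` occurs in `Γ'`, or is an existential formula of which `Γ'` has an instance, with a term of
level in `d`. -/
def InvL (d : Option Idx) (Γ' : Finset Formula) (A : Formula) : Prop :=
  A ∈ Γ' ∨ ∃ (F : Fml Term true 1) (δ : Idx) (s : Term), A = .ex rfl F ∧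
    δ ∈ d ∧ memT s (.E δ) ∈ Γ' ∧ F.inst s ∈ Γ'

/-- `Δ'` is `Δ`, or the instance of a universal formula `Δ` at a term declared in `Γ'`, of level
in `d`. -/
def InvR (d : Option Idx) (Γ' : Finset Formula) (Δ Δ' : Option Formula) : Prop :=
  Δ' = Δ ∨ ∃ (F : Fml Term true 1) (δ : Idx) (s : Term), Δ = some (.all rfl F) ∧
    δ ∈ d ∧ memT s (.E δ) ∈ Γ' ∧ Δ' = some (F.inst s)

/-- Adjunctions commute: ε is the parameter of a rule passed through during inversion, δ the level
at which one inverts. -/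
theorem Op.adj_adj_subset {H H' : Op} {δ : Ordinal.{0}} (h : ∀ X, H.adj δ X ⊆ H' X)
    (ε : Ordinal.{0}) (X : Set Ordinal.{0}) : (H.adj ε).adj δ X ⊆ H'.adj ε X := by
  have := h (X ∪ {ε})
  unfold Op.adj at *
  rwa [Set.union_right_comm]

theorem Op.adj_self_subset {H H' : Op} {δ : Ordinal.{0}} (h : ∀ X, H.adj δ X ⊆ H' X)
    (X : Set Ordinal.{0}) : (H.adj δ).adj δ X ⊆ H' X := by
  have := h X
  unfold Op.adj at *
  rwa [Set.union_assoc, Set.union_self]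

section Inv

variable {d : Option Idx} {Γ Γ' : Finset Formula} {Δ Δ' : Option Formula}

theorem InvL.cons {A : Formula} (h : InvL d Γ' A) (Q : Formula) :
    InvL d (insert Q Γ') A := by
  obtain h | ⟨F, δ, s, h₁, h₂, h₃, h₄⟩ := h
  · exact Or.inl (Finset.mem_insert_of_mem h)
  · exact Or.inr ⟨F, δ, s, h₁, h₂, Finset.mem_insert_of_mem h₃, Finset.mem_insert_of_mem h₄⟩

theorem InvL.of_insert {Q : Formula} (hQ : Q ∈ Γ') (h : ∀ A ∈ Γ, InvL d Γ' A) :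
    ∀ A ∈ insert Q Γ, InvL d Γ' A := by
  intro A hA
  obtain rfl | hA := Finset.mem_insert.1 hA
  · exact Or.inl hQ
  · exact h A hA

theorem InvL.cons_all (h : ∀ A ∈ Γ, InvL d Γ' A) (Q : Formula) :
    ∀ A ∈ insert Q Γ, InvL d (insert Q Γ') A :=
  InvL.of_insert (Finset.mem_insert_self _ _) fun A hA => (h A hA).cons Q

theorem InvL.mem {A : Formula} (h : ∀ B ∈ insert A Γ, InvL d Γ' B)
    (hA : ∀ F, A ≠ .ex rfl F) : A ∈ Γ' := by
  obtain h | ⟨F, δ, s, h, _⟩ := h A (Finset.mem_insert_self _ _)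
  · exact h
  · exact absurd h (hA F)

theorem InvL.tail {A : Formula} (h : ∀ B ∈ insert A Γ, InvL d Γ' B) :
    ∀ B ∈ Γ, InvL d Γ' B :=
  fun B hB => h B (Finset.mem_insert_of_mem hB)

theorem InvR.cons (h : InvR d Γ' Δ Δ') (Q : Formula) : InvR d (insert Q Γ') Δ Δ' := by
  obtain h | ⟨F, δ, s, h₁, h₂, h₃, h₄⟩ := h
  · exact Or.inl h
  · exact Or.inr ⟨F, δ, s, h₁, h₂, Finset.mem_insert_of_mem h₃, h₄⟩

theorem InvR.refl : InvR d Γ' Δ Δ := Or.inl rfl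

theorem InvR.eq_none (h : InvR d Γ' none Δ') : Δ' = none := by
  obtain h | ⟨F, δ, s, h, _⟩ := h
  · exact h
  · cases h

theorem InvR.eq_some {A : Formula} (h : InvR d Γ' (some A) Δ')
    (hA : ∀ F, A ≠ .all rfl F) : Δ' = some A := by
  obtain h | ⟨F, δ, s, h, _⟩ := h
  · exact h
  · cases h; exact absurd rfl (hA F)

end Inv

/-- Weakening in all arguments, together with inversion of existential formulas in the antecedent
and of universal formulas in the succedent. -/
theorem Prov.weaken_inv {ρ ρ' α : Ordinal.{0}} {H : Op} {Γ : Finset Formula}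
    {Δ : Option Formula} {d : Option Idx} (hρ : ρ ≤ ρ') (hp : Prov ρ H α Γ Δ) :
    ∀ {H' : Op} {α' : Ordinal.{0}} {Γ' : Finset Formula} {Δ' : Option Formula},
      (∀ X, H X ⊆ H' X) → (∀ δ ∈ d, ∀ X, H.adj δ X ⊆ H' X) → α ≤ α' → α' ∈ H' ∅ →
      (∀ A ∈ Γ, InvL d Γ' A) → InvR d Γ' Δ Δ' → Prov ρ' H' α' Γ' Δ' := by
  induction hp with
  | ax hα h =>
    intro H' α' Γ' Δ' hH hd hle hα' hL hR
    obtain ⟨A, rfl, hA⟩ := h.isDelta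
    obtain rfl := hR.eq_some (by rintro F rfl; exact hA)
    refine .ax hα' (h.mono fun B hB hBd => ?_)
    obtain h | ⟨F, δ, s, rfl, _⟩ := hL B hB
    · exact h
    · exact hBd.elim
  | andL₁ hα h₀ p ih =>
    intro H' α' Γ' Δ' hH hd hle hα' hL hR
    exact .of_mem (InvL.mem hL nofun) (.andL₁ hα' (h₀.trans_le hle)
      (ih hH hd le_rfl (hH _ p.height_mem) (InvL.cons_all (InvL.tail hL) _) (hR.cons _)))
  | andL₂ hα h₀ p ih =>
    intro H' α' Γ' Δ' hH hd hle hα' hL hR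
    exact .of_mem (InvL.mem hL nofun) (.andL₂ hα' (h₀.trans_le hle)
      (ih hH hd le_rfl (hH _ p.height_mem) (InvL.cons_all (InvL.tail hL) _) (hR.cons _)))
  | andR hα h₀ p q ih₁ ih₂ =>
    intro H' α' Γ' Δ' hH hd hle hα' hL hR
    obtain rfl := hR.eq_some nofun
    exact .andR hα' (h₀.trans_le hle) (ih₁ hH hd le_rfl (hH _ p.height_mem) hL .refl)
      (ih₂ hH hd le_rfl (hH _ q.height_mem) hL .refl)
  | orL hα h₀ p q ih₁ ih₂ =>
    intro H' α' Γ' Δ' hH hd hle hα' hL hR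
    exact .of_mem (InvL.mem hL nofun) (.orL hα' (h₀.trans_le hle)
      (ih₁ hH hd le_rfl (hH _ p.height_mem) (InvL.cons_all (InvL.tail hL) _) (hR.cons _))
      (ih₂ hH hd le_rfl (hH _ q.height_mem) (InvL.cons_all (InvL.tail hL) _) (hR.cons _)))
  | orR₁ hα h₀ p ih =>
    intro H' α' Γ' Δ' hH hd hle hα' hL hR
    obtain rfl := hR.eq_some nofun
    exact .orR₁ hα' (h₀.trans_le hle) (ih hH hd le_rfl (hH _ p.height_mem) hL .refl)
  | orR₂ hα h₀ p ih =>
    intro H' α' Γ' Δ' hH hd hle hα' hL hR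
    obtain rfl := hR.eq_some nofun
    exact .orR₂ hα' (h₀.trans_le hle) (ih hH hd le_rfl (hH _ p.height_mem) hL .refl)
  | negL hα h₀ p ih =>
    intro H' α' Γ' Δ' hH hd hle hα' hL hR
    obtain rfl := hR.eq_none
    exact .of_mem (InvL.mem hL nofun) (.negL hα' (h₀.trans_le hle)
      (ih hH hd le_rfl (hH _ p.height_mem) (InvL.tail hL) .refl))
  | negR hα h₀ p ih =>
    intro H' α' Γ' Δ' hH hd hle hα' hL hR
    obtain rfl := hR.eq_some nofun
    exact .negR hα' (h₀.trans_le hle)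
      (ih hH hd le_rfl (hH _ p.height_mem) (InvL.cons_all hL _) .refl)
  | bot hα h₀ p ih =>
    intro H' α' Γ' Δ' hH hd hle hα' hL hR
    have h := ih hH hd le_rfl (hH _ p.height_mem) hL .refl
    obtain rfl | ⟨F, δ, s, _, _, _, rfl⟩ := hR
    · exact .bot hα' (h₀.trans_le hle) h
    · exact .bot hα' (h₀.trans_le hle) h
  | impL hα h₀ p q ih₁ ih₂ =>
    intro H' α' Γ' Δ' hH hd hle hα' hL hR
    exact .of_mem (InvL.mem hL nofun) (.impL hα' (h₀.trans_le hle)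
      (ih₁ hH hd le_rfl (hH _ p.height_mem) (InvL.cons_all (InvL.tail hL) _) (hR.cons _))
      (ih₂ hH hd le_rfl (hH _ q.height_mem) (InvL.tail hL) .refl))
  | impR hα h₀ p ih =>
    intro H' α' Γ' Δ' hH hd hle hα' hL hR
    obtain rfl := hR.eq_some nofun
    exact .impR hα' (h₀.trans_le hle)
      (ih hH hd le_rfl (hH _ p.height_mem) (InvL.cons_all hL _) .refl)
  | lim hα hγ hγH ha p ih =>
    intro H' α' Γ' Δ' hH hd hle hα' hL hR
    exact .of_mem (InvL.mem hL nofun) (.lim hα' hγ (hH _ hγH)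
      (fun δ hδ => (ha δ hδ).trans_le hle) fun δ hδ =>
        ih δ hδ (fun _ => hH _) (fun ε hε => Op.adj_adj_subset (hd ε hε) δ) le_rfl
          (hH _ (p δ hδ).height_mem) (InvL.cons_all (InvL.tail hL) _) (hR.cons _))
  | ballL hα h₀ h₁ h₂ hβ hγ hγα hγβ p q r ih₁ ih₂ ih₃ =>
    intro H' α' Γ' Δ' hH hd hle hα' hL hR
    exact .of_mem (InvL.mem hL nofun) (.ballL hα' (h₀.trans_le hle) (h₁.trans_le hle)
      (h₂.trans_le hle) (hH _ hβ) (hH _ hγ) (hγα.trans_le hle) hγβ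
      (ih₁ hH hd le_rfl (hH _ p.height_mem) (InvL.cons_all (InvL.tail hL) _) (hR.cons _))
      (ih₂ hH hd le_rfl (hH _ q.height_mem) (InvL.tail hL) .refl)
      (ih₃ hH hd le_rfl (hH _ r.height_mem) (InvL.tail hL) .refl))
  | ballR hα h₀ h₁ hβ hβα p q ih₁ ih₂ =>
    intro H' α' Γ' Δ' hH hd hle hα' hL hR
    obtain rfl := hR.eq_some nofun
    exact .ballR hα' (h₀.trans_le hle) (h₁.trans_le hle) (hH _ hβ) (hβα.trans_le hle)
      (fun s => ih₁ s hH hd le_rfl (hH _ (p s).height_mem) hL .refl)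
      (ih₂ hH hd le_rfl (hH _ q.height_mem) hL .refl)
  | bexL hα h₀ h₁ hβ hβα p q ih₁ ih₂ =>
    intro H' α' Γ' Δ' hH hd hle hα' hL hR
    exact .of_mem (InvL.mem hL nofun) (.bexL hα' (h₀.trans_le hle) (h₁.trans_le hle) (hH _ hβ)
      (hβα.trans_le hle)
      (fun s => ih₁ s hH hd le_rfl (hH _ (p s).height_mem) (InvL.cons_all (InvL.tail hL) _)
        (hR.cons _))
      (ih₂ hH hd le_rfl (hH _ q.height_mem) (InvL.tail hL) .refl))
  | bexR hα h₀ h₁ h₂ hβ hγ hγα hγβ p q r ih₁ ih₂ ih₃ =>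
    intro H' α' Γ' Δ' hH hd hle hα' hL hR
    obtain rfl := hR.eq_some nofun
    exact .bexR hα' (h₀.trans_le hle) (h₁.trans_le hle)
      (h₂.trans_le hle) (hH _ hβ) (hH _ hγ) (hγα.trans_le hle) hγβ
      (ih₁ hH hd le_rfl (hH _ p.height_mem) hL .refl)
      (ih₂ hH hd le_rfl (hH _ q.height_mem) hL .refl)
      (ih₃ hH hd le_rfl (hH _ r.height_mem) hL .refl)
  | eballL hα h₀ h₁ h₂ h₃ hβ hγ hδ hδα hδm q₀ q₁ q₂ q₃ ih₀ ih₁ ih₂ ih₃ =>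
    intro H' α' Γ' Δ' hH hd hle hα' hL hR
    exact .of_mem (InvL.mem hL nofun) (.eballL hα' (h₀.trans_le hle) (h₁.trans_le hle)
      (h₂.trans_le hle) (h₃.trans_le hle) (hH _ hβ) (hH _ hγ) (hH _ hδ) (hδα.trans_le hle) hδm
      (ih₀ hH hd le_rfl (hH _ q₀.height_mem) (InvL.cons_all (InvL.tail hL) _) (hR.cons _))
      (ih₁ hH hd le_rfl (hH _ q₁.height_mem) (InvL.tail hL) .refl)
      (ih₂ hH hd le_rfl (hH _ q₂.height_mem) (InvL.tail hL) .refl)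
      (ih₃ hH hd le_rfl (hH _ q₃.height_mem) (InvL.tail hL) .refl))
  | eballR hα h₀ h₁ h₂ hβ hγ hm q₀ q₁ q₂ ih₀ ih₁ ih₂ =>
    intro H' α' Γ' Δ' hH hd hle hα' hL hR
    obtain rfl := hR.eq_some nofun
    exact .eballR hα' (h₀.trans_le hle) (h₁.trans_le hle) (h₂.trans_le hle) (hH _ hβ) (hH _ hγ)
      (hm.trans hle)
      (fun s => ih₀ s hH hd le_rfl (hH _ (q₀ s).height_mem) hL .refl)
      (ih₁ hH hd le_rfl (hH _ q₁.height_mem) hL .refl)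
      (ih₂ hH hd le_rfl (hH _ q₂.height_mem) hL .refl)
  | ebexL hα h₀ h₁ h₂ hβ hγ hm q₀ q₁ q₂ ih₀ ih₁ ih₂ =>
    intro H' α' Γ' Δ' hH hd hle hα' hL hR
    exact .of_mem (InvL.mem hL nofun) (.ebexL hα' (h₀.trans_le hle) (h₁.trans_le hle)
      (h₂.trans_le hle) (hH _ hβ) (hH _ hγ) (hm.trans hle)
      (fun s => ih₀ s hH hd le_rfl (hH _ (q₀ s).height_mem) (InvL.cons_all (InvL.tail hL) _)
        (hR.cons _))
      (ih₁ hH hd le_rfl (hH _ q₁.height_mem) (InvL.tail hL) .refl)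
      (ih₂ hH hd le_rfl (hH _ q₂.height_mem) (InvL.tail hL) .refl))
  | ebexR hα h₀ h₁ h₂ h₃ hβ hγ hδ hδα hδm q₀ q₁ q₂ q₃ ih₀ ih₁ ih₂ ih₃ =>
    intro H' α' Γ' Δ' hH hd hle hα' hL hR
    obtain rfl := hR.eq_some nofun
    exact .ebexR hα' (h₀.trans_le hle) (h₁.trans_le hle)
      (h₂.trans_le hle) (h₃.trans_le hle) (hH _ hβ) (hH _ hγ) (hH _ hδ) (hδα.trans_le hle) hδm
      (ih₀ hH hd le_rfl (hH _ q₀.height_mem) hL .refl)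
      (ih₁ hH hd le_rfl (hH _ q₁.height_mem) hL .refl)
      (ih₂ hH hd le_rfl (hH _ q₂.height_mem) hL .refl)
      (ih₃ hH hd le_rfl (hH _ q₃.height_mem) hL .refl)
  | allL hα h₀ h₁ hβα hβ p q ih₁ ih₂ =>
    intro H' α' Γ' Δ' hH hd hle hα' hL hR
    exact .of_mem (InvL.mem hL nofun) (.allL hα' (h₀.trans_le hle) (h₁.trans_le hle)
      (hβα.trans_le hle) (hH _ hβ)
      (ih₁ hH hd le_rfl (hH _ p.height_mem) (InvL.cons_all (InvL.tail hL) _) (hR.cons _))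
      (ih₂ hH hd le_rfl (hH _ q.height_mem) (InvL.tail hL) .refl))
  | allR hα ha p ih =>
    intro H' α' Γ' Δ' hH hd hle hα' hL hR
    obtain rfl | ⟨F, δ, s, hF, hδ, hmem, rfl⟩ := hR
    · exact .allR hα' (fun β => ⟨(ha β).1, (ha β).2.trans_le hle⟩) fun β s =>
        ih β s (fun _ => hH _) (fun ε hε => Op.adj_adj_subset (hd ε hε) β) le_rfl
          (hH _ (p β s).height_mem) (InvL.cons_all hL _) .refl
    · cases hF
      -- The wanted instance is itself a premise. Its operator `H.adj δ` is contained in `H'`, and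
      -- its extra antecedent formula is already in `Γ'`. Adjoining δ twice adds nothing, so the
      -- induction hypothesis applies with the same `d`.
      refine ih δ s (hd δ hδ) (fun ε hε => ?_) ((le_self_add.trans_lt (ha δ).2).le.trans hle) hα'
        (InvL.of_insert hmem hL) .refl
      obtain rfl := Option.mem_unique hδ hε
      exact Op.adj_self_subset (hd δ hδ)
  | exL hα ha p ih =>
    intro H' α' Γ' Δ' hH hd hle hα' hL hR
    obtain hP | ⟨F, δ, s, hF, hδ, hmem, hmem'⟩ := hL _ (Finset.mem_insert_self _ _)
    · exact .of_mem hP (.exL hα' (fun β => ⟨(ha β).1, (ha β).2.trans_le hle⟩) fun β s =>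
        ih β s (fun _ => hH _) (fun ε hε => Op.adj_adj_subset (hd ε hε) β) le_rfl
          (hH _ (p β s).height_mem) (InvL.cons_all (InvL.cons_all (InvL.tail hL) _) _)
          ((hR.cons _).cons _))
    · cases hF
      -- The principal formula may recur in the context; the induction hypothesis inverts such a
      -- copy too.
      refine ih δ s (hd δ hδ) (fun ε hε => ?_) ((le_self_add.trans_lt (ha δ).2).le.trans hle) hα'
        (InvL.of_insert hmem (InvL.of_insert hmem' (InvL.tail hL))) hR
      obtain rfl := Option.mem_unique hδ hε
      exact Op.adj_self_subset (hd δ hδ)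
  | exR hα h₀ h₁ hβα hβ p q ih₁ ih₂ =>
    intro H' α' Γ' Δ' hH hd hle hα' hL hR
    obtain rfl := hR.eq_some nofun
    exact .exR hα' (h₀.trans_le hle) (h₁.trans_le hle) (hβα.trans_le hle) (hH _ hβ)
      (ih₁ hH hd le_rfl (hH _ p.height_mem) hL .refl)
      (ih₂ hH hd le_rfl (hH _ q.height_mem) hL .refl)
  | ref hα h₀ hΩ hA p ih =>
    intro H' α' Γ' Δ' hH hd hle hα' hL hR
    obtain rfl := hR.eq_some nofun
    exact .ref hα' (h₀.trans_le hle) (hΩ.trans_le hle) hA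
      (ih hH hd le_rfl (hH _ p.height_mem) hL .refl)
  | cut hα h₀ h₁ h₂ hr hb p q r ih₁ ih₂ ih₃ =>
    intro H' α' Γ' Δ' hH hd hle hα' hL hR
    exact .cut hα' (h₀.trans_le hle) (h₁.trans_le hle) (h₂.trans_le hle) (hr.trans_le hρ)
      (fun s hs => hH _ (hb s hs))
      (ih₁ hH hd le_rfl (hH _ p.height_mem) (InvL.cons_all hL _) (hR.cons _))
      (ih₂ hH hd le_rfl (hH _ q.height_mem) hL .refl)
      (fun s hs => ih₃ s hs hH hd le_rfl (hH _ (r s hs).height_mem) hL .refl)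

theorem Prov.weaken {ρ ρ' α α' : Ordinal.{0}} {H H' : Op} {Γ Γ' : Finset Formula}
    {Δ : Option Formula} (hp : Prov ρ H α Γ Δ) (hρ : ρ ≤ ρ') (hH : ∀ X, H X ⊆ H' X)
    (hα : α ≤ α') (hα' : α' ∈ H' ∅) (hΓ : Γ ⊆ Γ') : Prov ρ' H' α' Γ' Δ :=
  hp.weaken_inv (d := none) hρ hH nofun hα hα' (fun _ hA => Or.inl (hΓ hA)) .refl

theorem Prov.exL_inv {ρ α : Ordinal.{0}} {H H' : Op} {Γ : Finset Formula} {Δ : Option Formula}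
    {F : Fml Term true 1} (hp : Prov ρ H α (insert (.ex rfl F) Γ) Δ) (hH : ∀ X, H X ⊆ H' X)
    (δ : Idx) (hδ : ∀ X, H.adj δ X ⊆ H' X) (s : Term) :
    Prov ρ H' α (insert (memT s (.E δ)) (insert (F.inst s) Γ)) Δ := by
  refine hp.weaken_inv (d := some δ) le_rfl hH (fun ε hε => ?_) le_rfl (hH _ hp.height_mem)
    (fun A hA => ?_) .refl
  · cases hε; exact hδ
  · obtain rfl | hA := Finset.mem_insert.1 hA
    · exact Or.inr ⟨F, δ, s, rfl, rfl, by simp, by simp⟩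
    · exact Or.inl (by simp [hA])

theorem Prov.allR_inv {ρ α : Ordinal.{0}} {H H' : Op} {Γ : Finset Formula}
    {F : Fml Term true 1} (hp : Prov ρ H α Γ (some (.all rfl F))) (hH : ∀ X, H X ⊆ H' X)
    (δ : Idx) (hδ : ∀ X, H.adj δ X ⊆ H' X) (s : Term) :
    Prov ρ H' α (insert (memT s (.E δ)) Γ) (some (F.inst s)) := by
  refine hp.weaken_inv (d := some δ) le_rfl hH (fun ε hε => ?_) le_rfl (hH _ hp.height_mem)
    (fun A hA => Or.inl (by simp [hA])) (Or.inr ⟨F, δ, s, rfl, rfl, by simp, rfl⟩)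
  cases hε; exact hδ

/-! ### Boundedness -/

/-- Closure properties of the operators `H_η[X]`. -/
structure Op.Closed (H : Op) : Prop where
  mono : ∀ {X Y : Set Ordinal.{0}}, X ⊆ Y → H X ⊆ H Y
  zero : ∀ X, 0 ∈ H X
  one : ∀ X, 1 ∈ H X
  add : ∀ {X : Set Ordinal.{0}} {ξ ζ : Ordinal.{0}}, ξ ∈ H X → ζ ∈ H X → ξ + ζ ∈ H X

theorem Op.Closed.natCast {H : Op} (hH : H.Closed) (X : Set Ordinal.{0}) (n : ℕ) :
    (n : Ordinal.{0}) ∈ H X := by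
  induction n with
  | zero => rw [Nat.cast_zero]; exact hH.zero X
  | succ n ih => push_cast; exact hH.add ih (hH.one X)

theorem Op.max_mem {H : Op} {X : Set Ordinal.{0}} {ξ ζ : Ordinal.{0}}
    (h₁ : ξ ∈ H X) (h₂ : ζ ∈ H X) : max ξ ζ ∈ H X := by
  obtain h | h := max_choice ξ ζ <;> rwa [h]

theorem Op.Closed.adj {H : Op} (hH : H.Closed) (δ : Ordinal.{0}) : (H.adj δ).Closed where
  mono h := hH.mono (Set.union_subset_union_left _ h)
  zero _ := hH.zero _
  one _ := hH.one _
  add h₁ h₂ := hH.add h₁ h₂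

theorem Op.Closed.subset_adj {H : Op} (hH : H.Closed) (δ : Ordinal.{0})
    (X : Set Ordinal.{0}) : H X ⊆ H.adj δ X := hH.mono Set.subset_union_left

theorem closed_Hop (η : Ordinal.{0}) : (Hop η).Closed where
  mono h _ hξ α hY hα := hξ α (h.trans hY) hα
  zero _ _ _ _ := BClosure.zero
  one _ α _ _ := B_one α
  add h₁ h₂ α hX hα := B_add (h₁ α hX hα) (h₂ α hX hα)

/-- The successor of an index. -/
noncomputable def Idx.succ (β : Idx) : Idx :=
  ⟨β + 1, by simpa using add_mem_OT β.2.1 (natCast_mem_OT 1),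
    isSuccLimit_Om.add_one_lt β.2.2⟩

theorem Idx.lt_succ (β : Idx) : β < β.succ := Subtype.mk_lt_mk.2 (lt_add_one _)

theorem Idx.lt_succ_of_lt {γ β : Idx} (h : γ < β) : γ < β.succ := h.trans β.lt_succ

/-- `A'` is `A`, or `A` belongs to the class given by `pol` and `A'` is `A` relativised to
`𝔼_β`. -/
def Bdd (β : Idx) (pol : Bool) (A A' : Formula) : Prop :=
  A' = A ∨ (SigPi pol A ∧ A' = A.rel (.cst (.E β)))

/-- Every formula of `Γ` has its counterpart in `Γ'`. -/
def BddL (β : Idx) (Γ Γ' : Finset Formula) : Prop := ∀ A ∈ Γ, ∃ A' ∈ Γ', Bdd β false A A'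

section Bdd

variable {β : Idx} {pol : Bool}

theorem Bdd.refl {A : Formula} : Bdd β pol A A := Or.inl rfl

theorem Bdd.eq_of_isDelta {A A' : Formula} (h : Bdd β pol A A') (hA : A.IsDelta) : A' = A := by
  obtain h | ⟨_, h⟩ := h
  · exact h
  · rw [h, hA.rel_eq]

theorem Bdd.and {A C P : Formula} (h : Bdd β pol (.and A C) P) :
    ∃ A' C', P = .and A' C' ∧ Bdd β pol A A' ∧ Bdd β pol C C' := by
  obtain rfl | ⟨h, rfl⟩ := h
  · exact ⟨_, _, rfl, .refl, .refl⟩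
  · exact ⟨_, _, rfl, Or.inr ⟨(sigPi_and.1 h).1, rfl⟩, Or.inr ⟨(sigPi_and.1 h).2, rfl⟩⟩

theorem Bdd.or {A C P : Formula} (h : Bdd β pol (.or A C) P) :
    ∃ A' C', P = .or A' C' ∧ Bdd β pol A A' ∧ Bdd β pol C C' := by
  obtain rfl | ⟨h, rfl⟩ := h
  · exact ⟨_, _, rfl, .refl, .refl⟩
  · exact ⟨_, _, rfl, Or.inr ⟨(sigPi_or.1 h).1, rfl⟩, Or.inr ⟨(sigPi_or.1 h).2, rfl⟩⟩

theorem Bdd.imp {A C P : Formula} (h : Bdd β pol (.imp A C) P) :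
    ∃ A' C', P = .imp A' C' ∧ Bdd β (!pol) A A' ∧ Bdd β pol C C' := by
  obtain rfl | ⟨h, rfl⟩ := h
  · exact ⟨_, _, rfl, .refl, .refl⟩
  · exact ⟨_, _, rfl, Or.inr ⟨(sigPi_imp.1 h).1, rfl⟩, Or.inr ⟨(sigPi_imp.1 h).2, rfl⟩⟩

theorem Bdd.neg {A P : Formula} (h : Bdd β pol (.neg A) P) :
    ∃ A', P = .neg A' ∧ Bdd β (!pol) A A' := by
  obtain rfl | ⟨h, rfl⟩ := h
  · exact ⟨_, rfl, .refl⟩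
  · exact ⟨_, rfl, Or.inr ⟨sigPi_neg.1 h, rfl⟩⟩

theorem Bdd.inst {A : Fml Term true 1} (h : SigPi pol A) (s : Term) :
    Bdd β pol (A.inst s) ((A.rel (.cst (.E β))).inst s) :=
  Or.inr ⟨h.inst s, A.rel_inst s _⟩

theorem Bdd.ball {t : Term} {A : Fml Term true 1} {P : Formula}
    (h : Bdd β pol (.ball (.cst t) A) P) :
    ∃ A' : Fml Term true 1, P = .ball (.cst t) A' ∧ ∀ s, Bdd β pol (A.inst s) (A'.inst s) := by
  obtain rfl | ⟨h, rfl⟩ := h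
  · exact ⟨_, rfl, fun _ => .refl⟩
  · exact ⟨_, rfl, Bdd.inst (sigPi_ball.1 h)⟩

theorem Bdd.bex {t : Term} {A : Fml Term true 1} {P : Formula}
    (h : Bdd β pol (.bex (.cst t) A) P) :
    ∃ A' : Fml Term true 1, P = .bex (.cst t) A' ∧ ∀ s, Bdd β pol (A.inst s) (A'.inst s) := by
  obtain rfl | ⟨h, rfl⟩ := h
  · exact ⟨_, rfl, fun _ => .refl⟩
  · exact ⟨_, rfl, Bdd.inst (sigPi_bex.1 h)⟩

theorem Bdd.eball {s t : Term} {A : Fml Term true 1} {P : Formula}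
    (h : Bdd β pol (.eball (.cst s) (.cst t) A) P) :
    ∃ A' : Fml Term true 1, P = .eball (.cst s) (.cst t) A' ∧
      ∀ p, Bdd β pol (A.inst p) (A'.inst p) := by
  obtain rfl | ⟨h, rfl⟩ := h
  · exact ⟨_, rfl, fun _ => .refl⟩
  · exact ⟨_, rfl, Bdd.inst (sigPi_eball.1 h)⟩

theorem Bdd.ebex {s t : Term} {A : Fml Term true 1} {P : Formula}
    (h : Bdd β pol (.ebex (.cst s) (.cst t) A) P) :
    ∃ A' : Fml Term true 1, P = .ebex (.cst s) (.cst t) A' ∧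
      ∀ p, Bdd β pol (A.inst p) (A'.inst p) := by
  obtain rfl | ⟨h, rfl⟩ := h
  · exact ⟨_, rfl, fun _ => .refl⟩
  · exact ⟨_, rfl, Bdd.inst (sigPi_ebex.1 h)⟩

theorem Bdd.all {A : Fml Term true 1} {P : Formula} (h : Bdd β pol (.all rfl A) P) :
    P = .all rfl A ∨ pol = false ∧ ∃ A' : Fml Term true 1, P = .ball (.cst (.E β)) A' ∧
      ∀ s, Bdd β pol (A.inst s) (A'.inst s) := by
  obtain rfl | ⟨h, rfl⟩ := h
  · exact Or.inl rfl
  · exact Or.inr ⟨(sigPi_all.1 h).1, _, rfl, Bdd.inst (sigPi_all.1 h).2⟩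

theorem Bdd.ex {A : Fml Term true 1} {P : Formula} (h : Bdd β pol (.ex rfl A) P) :
    P = .ex rfl A ∨ pol = true ∧ ∃ A' : Fml Term true 1, P = .bex (.cst (.E β)) A' ∧
      ∀ s, Bdd β pol (A.inst s) (A'.inst s) := by
  obtain rfl | ⟨h, rfl⟩ := h
  · exact Or.inl rfl
  · exact Or.inr ⟨(sigPi_ex.1 h).1, _, rfl, Bdd.inst (sigPi_ex.1 h).2⟩

/-- The guard of a bounded quantifier is Δ₀, so relativisation acts only on the matrix. -/
theorem Bdd.imp_right {A C C' : Formula} (hA : A.IsDelta) (h : Bdd β pol C C') :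
    Bdd β pol (.imp A C) (.imp A C') := by
  obtain rfl | ⟨h, rfl⟩ := h
  · exact .refl
  · exact Or.inr ⟨.imp (.delta hA) h, by rw [Fml.rel, hA.rel_eq]⟩

theorem Bdd.and_right {A C C' : Formula} (hA : A.IsDelta) (h : Bdd β pol C C') :
    Bdd β pol (.and A C) (.and A C') := by
  obtain rfl | ⟨h, rfl⟩ := h
  · exact .refl
  · exact Or.inr ⟨.and (.delta hA) h, by rw [Fml.rel, hA.rel_eq]⟩

theorem BddL.cons {Γ Γ' : Finset Formula} (h : BddL β Γ Γ') {A A' : Formula}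
    (hA : Bdd β false A A') : BddL β (insert A Γ) (insert A' Γ') := by
  intro B hB
  obtain rfl | hB := Finset.mem_insert.1 hB
  · exact ⟨A', Finset.mem_insert_self _ _, hA⟩
  · obtain ⟨B', h₁, h₂⟩ := h B hB
    exact ⟨B', Finset.mem_insert_of_mem h₁, h₂⟩

theorem BddL.tail {Γ Γ' : Finset Formula} {A : Formula} (h : BddL β (insert A Γ) Γ') :
    BddL β Γ Γ' := fun B hB => h B (Finset.mem_insert_of_mem hB)

theorem BddL.head {Γ Γ' : Finset Formula} {A : Formula} (h : BddL β (insert A Γ) Γ') :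
    ∃ A' ∈ Γ', Bdd β false A A' := h A (Finset.mem_insert_self _ _)

end Bdd

/-- `Γ ⇒ 𝔼_γ ∈ 𝔼_β` for `γ < β`. -/
theorem Prov.E_mem_E {ρ α : Ordinal.{0}} {H : Op} {Γ : Finset Formula} {γ β : Idx}
    (h : γ < β) (hα : α ∈ H ∅) : Prov ρ H α Γ (some (memT (.E γ) (.E β))) :=
  .ax hα (.e4 γ β h)

theorem params_memT {s t p : Term} (h : p ∈ (memT s t).params) : p = s ∨ p = t := by
  obtain h | h := h <;> cases h
  · exact Or.inl rfl
  · exact Or.inr rfl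

/-- From `Γ ⇒ s ∈ 𝔼_γ` to `Γ ⇒ s ∈ 𝔼_β` for `γ < β`. -/
theorem Prov.mem_E_of_lt {ρ α : Ordinal.{0}} {H : Op} {Γ : Finset Formula} {s : Term}
    {γ β : Idx} (hH : H.Closed) (hρ : (β : Ordinal.{0}) + 1 < ρ) (h : γ < β)
    (hγ : (γ : Ordinal.{0}) ∈ H ∅) (hβ : (β : Ordinal.{0}) ∈ H ∅)
    (p : Prov ρ H α Γ (some (memT s (.E γ)))) :
    Prov ρ H (α + 2) Γ (some (memT s (.E β))) := by
  classical
  have hsucc : ∀ δ : Idx, (δ : Ordinal.{0}) ∈ H ∅ → (δ.succ : Ordinal.{0}) ∈ H ∅ :=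
    fun δ hδ => hH.add hδ (hH.one _)
  have h2 : (2 : Ordinal.{0}) ∈ H ∅ := by simpa using hH.natCast ∅ 2
  have hα : α + 2 ∈ H ∅ := hH.add p.height_mem h2
  have hαlt : α < α + 2 := lt_add_of_pos_right α two_pos
  -- (E6) with 𝔼_γ as the middle term. The cut with 𝔼_γ ∈ 𝔼_β gives both terms level β + 1, the
  -- largest rank used here, whence the bound on ρ.
  have hin : Prov ρ H 1 (insert (memT s (.E γ)) Γ) (some (memT s (.E β))) := by
    refine .cut (A := memT (.E γ) (.E β)) (b := fun _ => β.succ) (hH.one _) zero_lt_one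
      zero_lt_one zero_lt_one ?_ (fun _ _ => hsucc β hβ)
      (.ax (hH.zero _) (.e6 β s (.E γ) (by simp) (by simp))) (.E_mem_E h (hH.zero _))
      (fun t ht => ?_)
    · exact (max_self _).trans_lt hρ
    · obtain rfl | rfl := params_memT ht
      · exact .E_mem_E (Idx.lt_succ_of_lt h) (hH.zero _)
      · exact .E_mem_E β.lt_succ (hH.zero _)
  -- By (E4) the term 𝔼_γ is declared at level γ + 1, while s keeps its known level γ. The case
  -- distinction also covers s = 𝔼_γ.
  refine .cut (A := memT s (.E γ)) (b := fun t => if t = .E γ then γ.succ else γ) hα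
    (α₀ := 1) (one_lt_two.trans_le le_add_self) hαlt hαlt ?_ (fun t _ => ?_) hin p
    (fun t ht => ?_)
  · have h1 : (γ : Ordinal.{0}) + 1 < ρ :=
      (add_le_add_left (show (γ : Ordinal.{0}) ≤ β from h.le) 1).trans_lt hρ
    have hle : ∀ t : Term, ((if t = .E γ then γ.succ else γ : Idx) : Ordinal.{0}) < ρ := by
      intro t
      split_ifs
      · exact h1
      · exact le_self_add.trans_lt h1
    exact max_lt (hle _) (hle _)
  · split_ifs
    · exact hsucc γ hγ
    · exact hγ
  · split_ifs with he
    · rw [he]; exact .E_mem_E γ.lt_succ p.height_mem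
    · obtain rfl | rfl := params_memT ht
      · exact p
      · exact absurd rfl he

/-- This is where the increments of 3 in the unbounded quantifier rules are spent: two steps to lift
the witness to 𝔼_β, and one for the propositional rule joining it to the instance. -/
theorem max_add_two_add_one_lt {α α₀ α₁ : Ordinal.{0}} (h₀ : α₀ + 3 < α) (h₁ : α₁ + 3 < α) :
    max α₀ (α₁ + 2) + 1 < α := by
  obtain h | h := max_choice α₀ (α₁ + 2) <;> rw [h]
  · refine lt_of_le_of_lt ?_ h₀
    gcongr
    norm_num
  · rw [add_assoc]
    convert h₁ using 2
    norm_num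

/-- Boundedness: formulas of the succedent in `Σ^E`, and formulas of the antecedent in `Π^E`, may
be relativised to `𝔼_β` if `β` is at least the height of the derivation. -/
theorem Prov.bound {ρ α : Ordinal.{0}} {H : Op} {Γ : Finset Formula} {Δ : Option Formula}
    {β : Idx} (hρ : (β : Ordinal.{0}) + 1 < ρ) (hp : Prov ρ H α Γ Δ) :
    ∀ {Γ' : Finset Formula} {Δ' : Option Formula}, H.Closed → (β : Ordinal.{0}) ∈ H ∅ →
      α ≤ β → BddL β Γ Γ' → Option.Rel (Bdd β true) Δ Δ' → Prov ρ H α Γ' Δ' := by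
  have hsucc : ∀ {H : Op}, H.Closed → (β : Ordinal.{0}) ∈ H ∅ → (β.succ : Ordinal.{0}) ∈ H ∅ :=
    fun hH hβ => hH.add hβ (hH.one _)
  have hd : ∀ s t, (memT s t).IsDelta := fun _ _ => trivial
  have hf : ∀ p s t, (funT p s t).IsDelta := fun _ _ _ => isDelta_funF _ _ _
  induction hp with
  | ax hα h =>
    intro Γ' Δ' hH hβ hle hL hR
    obtain ⟨A, rfl, hA⟩ := h.isDelta
    cases hR with
    | some hR =>
      obtain rfl := hR.eq_of_isDelta hA
      refine .ax hα (h.mono fun B hB hBd => ?_)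
      obtain ⟨B', h₁, h₂⟩ := hL B hB
      rwa [← h₂.eq_of_isDelta hBd]
  | bot hα h₀ p ih =>
    intro Γ' Δ' hH hβ hle hL hR
    cases hR with
    | some hR => exact .bot hα h₀ (ih hH hβ (h₀.le.trans hle) hL .none)
  | andL₁ hα h₀ p ih =>
    intro Γ' Δ' hH hβ hle hL hR
    obtain ⟨P, hP, hb⟩ := hL.head
    obtain ⟨A', C', rfl, h₁, h₂⟩ := hb.and
    exact .of_mem hP (.andL₁ hα h₀ (ih hH hβ (h₀.le.trans hle) (hL.tail.cons h₁) hR))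
  | andL₂ hα h₀ p ih =>
    intro Γ' Δ' hH hβ hle hL hR
    obtain ⟨P, hP, hb⟩ := hL.head
    obtain ⟨A', C', rfl, h₁, h₂⟩ := hb.and
    exact .of_mem hP (.andL₂ hα h₀ (ih hH hβ (h₀.le.trans hle) (hL.tail.cons h₂) hR))
  | andR hα h₀ p q ih₁ ih₂ =>
    intro Γ' Δ' hH hβ hle hL hR
    cases hR with
    | some hR =>
    obtain ⟨A', C', rfl, h₁, h₂⟩ := hR.and
    exact .andR hα h₀ (ih₁ hH hβ (h₀.le.trans hle) hL (.some h₁))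
      (ih₂ hH hβ (h₀.le.trans hle) hL (.some h₂))
  | orL hα h₀ p q ih₁ ih₂ =>
    intro Γ' Δ' hH hβ hle hL hR
    obtain ⟨P, hP, hb⟩ := hL.head
    obtain ⟨A', C', rfl, h₁, h₂⟩ := hb.or
    exact .of_mem hP (.orL hα h₀ (ih₁ hH hβ (h₀.le.trans hle) (hL.tail.cons h₁) hR)
      (ih₂ hH hβ (h₀.le.trans hle) (hL.tail.cons h₂) hR))
  | orR₁ hα h₀ p ih =>
    intro Γ' Δ' hH hβ hle hL hR
    cases hR with
    | some hR =>
    obtain ⟨A', C', rfl, h₁, h₂⟩ := hR.or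
    exact .orR₁ hα h₀ (ih hH hβ (h₀.le.trans hle) hL (.some h₁))
  | orR₂ hα h₀ p ih =>
    intro Γ' Δ' hH hβ hle hL hR
    cases hR with
    | some hR =>
    obtain ⟨A', C', rfl, h₁, h₂⟩ := hR.or
    exact .orR₂ hα h₀ (ih hH hβ (h₀.le.trans hle) hL (.some h₂))
  | negL hα h₀ p ih =>
    intro Γ' Δ' hH hβ hle hL hR
    obtain ⟨P, hP, hb⟩ := hL.head
    obtain ⟨A', rfl, h₁⟩ := hb.neg
    cases hR
    exact .of_mem hP (.negL hα h₀ (ih hH hβ (h₀.le.trans hle) hL.tail (.some h₁)))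
  | negR hα h₀ p ih =>
    intro Γ' Δ' hH hβ hle hL hR
    cases hR with
    | some hR =>
    obtain ⟨A', rfl, h₁⟩ := hR.neg
    exact .negR hα h₀ (ih hH hβ (h₀.le.trans hle) (hL.cons h₁) .none)
  | impL hα h₀ p q ih₁ ih₂ =>
    intro Γ' Δ' hH hβ hle hL hR
    obtain ⟨P, hP, hb⟩ := hL.head
    obtain ⟨A', C', rfl, h₁, h₂⟩ := hb.imp
    exact .of_mem hP (.impL hα h₀ (ih₁ hH hβ (h₀.le.trans hle) (hL.tail.cons h₂) hR)
      (ih₂ hH hβ (h₀.le.trans hle) hL.tail (.some h₁)))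
  | impR hα h₀ p ih =>
    intro Γ' Δ' hH hβ hle hL hR
    cases hR with
    | some hR =>
    obtain ⟨A', C', rfl, h₁, h₂⟩ := hR.imp
    exact .impR hα h₀ (ih hH hβ (h₀.le.trans hle) (hL.cons h₁) (.some h₂))
  | ballL hα h₀ hh₁ h₂ hβ' hγ hγα hγβ p q r ih₁ ih₂ ih₃ =>
    intro Γ' Δ' hH hβ hle hL hR
    obtain ⟨P, hP, hb⟩ := hL.head
    obtain ⟨A', rfl, h₁⟩ := hb.ball
    exact .of_mem hP (.ballL hα h₀ hh₁ h₂ hβ' hγ hγα hγβ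
      (ih₁ hH hβ (h₀.le.trans hle) (hL.tail.cons (.imp_right (hd _ _) (h₁ _))) hR)
     
      (ih₂ hH hβ (hh₁.le.trans hle) hL.tail (.some .refl)) (ih₃ hH hβ (h₂.le.trans hle) hL.tail (.some .refl)))
  | ballR hα h₀ hh₁ hβ' hβα p q ih₁ ih₂ =>
    intro Γ' Δ' hH hβ hle hL hR
    cases hR with
    | some hR =>
    obtain ⟨A', rfl, h₁⟩ := hR.ball
    exact .ballR hα h₀ hh₁ hβ' hβα
      (fun s => ih₁ s hH hβ (h₀.le.trans hle) hL (.some (.imp_right (hd _ _) (h₁ s))))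
      (ih₂ hH hβ (hh₁.le.trans hle) hL (.some .refl))
  | bexL hα h₀ hh₁ hβ' hβα p q ih₁ ih₂ =>
    intro Γ' Δ' hH hβ hle hL hR
    obtain ⟨P, hP, hb⟩ := hL.head
    obtain ⟨A', rfl, h₁⟩ := hb.bex
    exact .of_mem hP (.bexL hα h₀ hh₁ hβ' hβα
      (fun s => ih₁ s hH hβ (h₀.le.trans hle) (hL.tail.cons (.and_right (hd _ _) (h₁ s))) hR)
      (ih₂ hH hβ (hh₁.le.trans hle) hL.tail (.some .refl)))
  | bexR hα h₀ hh₁ h₂ hβ' hγ hγα hγβ p q r ih₁ ih₂ ih₃ =>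
    intro Γ' Δ' hH hβ hle hL hR
    cases hR with
    | some hR =>
    obtain ⟨A', rfl, h₁⟩ := hR.bex
    exact .bexR hα h₀ hh₁ h₂ hβ' hγ hγα hγβ
      (ih₁ hH hβ (h₀.le.trans hle) hL (.some (.and_right (hd _ _) (h₁ _))))
      (ih₂ hH hβ (hh₁.le.trans hle) hL (.some .refl)) (ih₃ hH hβ (h₂.le.trans hle) hL (.some .refl))
  | eballL hα h₀ hh₁ h₂ h₃ hβ' hγ hδ hδα hδm q₀ q₁ q₂ q₃ ih₀ ih₁ ih₂ ih₃ =>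
    intro Γ' Δ' hH hβ hle hL hR
    obtain ⟨P, hP, hb⟩ := hL.head
    obtain ⟨A', rfl, h₁⟩ := hb.eball
    exact .of_mem hP (.eballL hα h₀ hh₁ h₂ h₃ hβ' hγ hδ hδα hδm
      (ih₀ hH hβ (h₀.le.trans hle) (hL.tail.cons (.imp_right (hf _ _ _) (h₁ _))) hR)
      (ih₁ hH hβ (hh₁.le.trans hle) hL.tail (.some .refl))
      (ih₂ hH hβ (h₂.le.trans hle) hL.tail (.some .refl))
      (ih₃ hH hβ (h₃.le.trans hle) hL.tail (.some .refl)))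
  | eballR hα h₀ hh₁ h₂ hβ' hγ hm q₀ q₁ q₂ ih₀ ih₁ ih₂ =>
    intro Γ' Δ' hH hβ hle hL hR
    cases hR with
    | some hR =>
    obtain ⟨A', rfl, h₁⟩ := hR.eball
    exact .eballR hα h₀ hh₁ h₂ hβ' hγ hm
      (fun s => ih₀ s hH hβ (h₀.le.trans hle) hL (.some (.imp_right (hf _ _ _) (h₁ s))))
      (ih₁ hH hβ (hh₁.le.trans hle) hL (.some .refl)) (ih₂ hH hβ (h₂.le.trans hle) hL (.some .refl))
  | ebexL hα h₀ hh₁ h₂ hβ' hγ hm q₀ q₁ q₂ ih₀ ih₁ ih₂ =>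
    intro Γ' Δ' hH hβ hle hL hR
    obtain ⟨P, hP, hb⟩ := hL.head
    obtain ⟨A', rfl, h₁⟩ := hb.ebex
    exact .of_mem hP (.ebexL hα h₀ hh₁ h₂ hβ' hγ hm
      (fun s => ih₀ s hH hβ (h₀.le.trans hle) (hL.tail.cons (.and_right (hf _ _ _) (h₁ s))) hR)
      (ih₁ hH hβ (hh₁.le.trans hle) hL.tail (.some .refl))
      (ih₂ hH hβ (h₂.le.trans hle) hL.tail (.some .refl)))
  | ebexR hα h₀ hh₁ h₂ h₃ hβ' hγ hδ hδα hδm q₀ q₁ q₂ q₃ ih₀ ih₁ ih₂ ih₃ =>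
    intro Γ' Δ' hH hβ hle hL hR
    cases hR with
    | some hR =>
    obtain ⟨A', rfl, h₁⟩ := hR.ebex
    exact .ebexR hα h₀ hh₁ h₂ h₃ hβ' hγ hδ hδα hδm
      (ih₀ hH hβ (h₀.le.trans hle) hL (.some (.and_right (hf _ _ _) (h₁ _))))
      (ih₁ hH hβ (hh₁.le.trans hle) hL (.some .refl)) (ih₂ hH hβ (h₂.le.trans hle) hL (.some .refl))
      (ih₃ hH hβ (h₃.le.trans hle) hL (.some .refl))
  | lim hα hγ hγH ha p ih =>
    intro Γ' Δ' hH hβ hle hL hR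
    obtain ⟨P, hP, hb⟩ := hL.head
    obtain rfl := hb.eq_of_isDelta (hd _ _)
    exact .of_mem hP (.lim hα hγ hγH ha fun δ hδ => ih δ hδ (hH.adj _)
      (hH.subset_adj _ _ hβ) ((ha δ hδ).le.trans hle) (hL.tail.cons .refl) hR)
  | @allL H α α₀ α₁ Γ Δ s A γ hα h₀ h₁ hγα hγ p q ih₁ ih₂ =>
    intro Γ' Δ' hH hβ hle hL hR
    have h₀' := le_self_add.trans_lt h₀
    have h₁' := le_self_add.trans_lt h₁
    obtain ⟨P, hP, hb⟩ := hL.head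
    have hq := ih₂ hH hβ (h₁'.le.trans hle) hL.tail (.some .refl)
    obtain rfl | ⟨_, A', rfl, hA⟩ := hb.all
    · exact .of_mem hP (.allL hα h₀ h₁ hγα hγ (ih₁ hH hβ (h₀'.le.trans hle)
        (hL.tail.cons .refl) hR) hq)
    · have hp := ih₁ hH hβ (h₀'.le.trans hle) (hL.tail.cons (hA s)) hR
      -- The side condition γ < α of the quantifier rule puts the witness below the bound, since α ≤
      -- β.
      have hγβ : γ < β := hγα.trans_le hle
      have hq' := hq.mem_E_of_lt hH hρ hγβ hγ hβ
      have hm := Op.max_mem hp.height_mem hq'.height_mem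
      -- The quantifier is now bounded by 𝔼_β, which (E4) declares at level β + 1 with height 0.
      refine .of_mem hP (.ballL (β := β.succ) (α₀ := max α₀ (α₁ + 2) + 1) (α₁ := 0) hα
        (max_add_two_add_one_lt h₀ h₁) (h₁.bot_lt) h₁' (hsucc hH hβ) hγ
        hγα (Idx.lt_succ_of_lt hγβ).le ?_ (.E_mem_E β.lt_succ (hH.zero _)) hq)
      exact .impL (hH.add hm (hH.one _)) (lt_add_one _)
        (hp.weaken le_rfl (fun _ => subset_rfl) (le_max_left _ _) hm subset_rfl)
        (hq'.weaken le_rfl (fun _ => subset_rfl) (le_max_right _ _) hm subset_rfl)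
  | allR hα ha p ih =>
    intro Γ' Δ' hH hβ hle hL hR
    cases hR with
    | some hR =>
    -- A universal succedent is not Σ^E, so it cannot have been relativised.
    obtain rfl | ⟨h, _⟩ := hR.all
    · exact .allR hα ha fun γ s => ih γ s (hH.adj _) (hH.subset_adj _ _ hβ)
        ((le_self_add.trans_lt (ha γ).2).le.trans hle) (hL.cons .refl) (.some .refl)
    · cases h
  | exL hα ha p ih =>
    intro Γ' Δ' hH hβ hle hL hR
    obtain ⟨P, hP, hb⟩ := hL.head
    obtain rfl | ⟨h, _⟩ := hb.ex
    · exact .of_mem hP (.exL hα ha fun γ s => ih γ s (hH.adj _) (hH.subset_adj _ _ hβ)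
        ((le_self_add.trans_lt (ha γ).2).le.trans hle) ((hL.tail.cons .refl).cons .refl) hR)
    · cases h
  | @exR H α α₀ α₁ Γ s A γ hα h₀ h₁ hγα hγ p q ih₁ ih₂ =>
    intro Γ' Δ' hH hβ hle hL hR
    have h₀' := le_self_add.trans_lt h₀
    have h₁' := le_self_add.trans_lt h₁
    have hq := ih₂ hH hβ (h₁'.le.trans hle) hL (.some .refl)
    cases hR with
    | some hR =>
    obtain rfl | ⟨_, A', rfl, hA⟩ := hR.ex
    · exact .exR hα h₀ h₁ hγα hγ (ih₁ hH hβ (h₀'.le.trans hle) hL (.some .refl)) hq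
    · have hp := ih₁ hH hβ (h₀'.le.trans hle) hL (.some (hA s))
      have hγβ : γ < β := hγα.trans_le hle
      have hq' := hq.mem_E_of_lt hH hρ hγβ hγ hβ
      have hm := Op.max_mem hp.height_mem hq'.height_mem
      refine .bexR (β := β.succ) (α₀ := max α₀ (α₁ + 2) + 1) (α₁ := 0) hα
        (max_add_two_add_one_lt h₀ h₁) (h₁.bot_lt) h₁' (hsucc hH hβ) hγ
        hγα (Idx.lt_succ_of_lt hγβ).le ?_ (.E_mem_E β.lt_succ (hH.zero _)) hq
      exact .andR (hH.add hm (hH.one _)) (lt_add_one _)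
        (hq'.weaken le_rfl (fun _ => subset_rfl) (le_max_right _ _) hm subset_rfl)
        (hp.weaken le_rfl (fun _ => subset_rfl) (le_max_left _ _) hm subset_rfl)
  | ref hα h₀ hΩ hA p ih =>
    intro Γ' Δ' hH hβ hle hL hR
    -- Reflection needs a height above Ω, but the height is at most β < Ω.
    exact absurd (hΩ.trans_le hle) β.2.2.not_gt
  | cut hα h₀ h₁ h₂ hr hb p q r ih₁ ih₂ ih₃ =>
    intro Γ' Δ' hH hβ hle hL hR
    -- The cut formula is not relativised in either premise; for this `Bdd` also admits the
    -- unchanged formula.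
    exact .cut hα h₀ h₁ h₂ hr hb (ih₁ hH hβ (h₀.le.trans hle) (hL.cons .refl) hR)
      (ih₂ hH hβ (h₁.le.trans hle) hL (.some .refl))
      (fun s hs => ih₃ s hs hH hβ (h₂.le.trans hle) hL (.some .refl))

/-! ### Ordinal estimates for collapsing -/

theorem Hop_mono {η η' : Ordinal.{0}} (h : η ≤ η') (X : Set Ordinal.{0}) :
    Hop η X ⊆ Hop η' X := fun _ hξ α hX hα => hξ α hX (h.trans_lt hα)

/-- Every B^Ω(α) that enters the intersection for η' already contains δ, so adjoining δ imposes no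
further restriction. -/
theorem Hop_adj_subset {η η' δ : Ordinal.{0}} (h : η ≤ η') (hδ : δ ∈ Hop η' ∅)
    (X : Set Ordinal.{0}) : (Hop η).adj δ X ⊆ Hop η' X := by
  intro ξ hξ α hX hα
  refine hξ α (Set.union_subset hX ?_) (h.trans_lt hα)
  rintro _ rfl
  exact hδ α (Set.empty_subset _) hα

/-- H_θ(∅) is B^Ω(θ+1), which is closed under ψ_Ω at θ itself. This is why the collapsed height is
controlled by the new operator. -/
theorem psi_mem_Hop {θ : Ordinal.{0}} (h : θ ∈ Hop θ ∅) : psi θ ∈ Hop θ ∅ :=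
  mem_Hop_empty.2 (B_psi (lt_add_one θ) (mem_Hop_empty.1 h))

theorem psi_add_one_lt {α ξ : Ordinal.{0}} (h : ξ < psi α) : ξ + 1 < psi α := by
  simpa using psi_add_natCast_lt h 1

/-- The index `ψ_Ω(θ)`. -/
noncomputable def psiIdx (θ : Ordinal.{0}) (h : θ ∈ OT) : Idx :=
  ⟨psi θ, psi_mem_OT h, psi_lt_Om θ⟩

section Stage

variable {η α α₀ α₁ : Ordinal.{0}}

theorem add_one_le_add_opow (η α : Ordinal.{0}) : η + 1 ≤ η + ω ^ α :=
  add_le_add_right (Order.one_le_iff_pos.2 (opow_pos α omega0_pos)) η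

theorem add_opow_lt (h : α₀ < α) : η + ω ^ α₀ < η + ω ^ α :=
  add_lt_add_right ((opow_lt_opow_iff_right one_lt_omega0).2 h) η

theorem add_opow_add_opow_lt (h₀ : α₀ < α) (h₁ : α₁ < α) :
    η + ω ^ α₁ + ω ^ α₀ < η + ω ^ α := by
  rw [add_assoc]
  exact add_lt_add_right (isPrincipal_add_omega0_opow α
    ((opow_lt_opow_iff_right one_lt_omega0).2 h₁)
    ((opow_lt_opow_iff_right one_lt_omega0).2 h₀)) η

theorem add_opow_mem_Hop (hη : η ∈ Hop η ∅) (h : α ∈ Hop η ∅) : η + ω ^ α ∈ Hop η ∅ :=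
  fun β hX hβ => B_add (hη β hX hβ) (B_opow (h β hX hβ))

theorem mem_B_of_mem_Hop {ξ θ : Ordinal.{0}} (h : ξ ∈ Hop η ∅) (hθ : η < θ) : ξ ∈ B θ :=
  h θ (Set.empty_subset _) hθ

theorem lt_add_opow (η α : Ordinal.{0}) : η < η + ω ^ α :=
  (lt_add_one η).trans_le (add_one_le_add_opow η α)

/-- As η < ε_{Ω+1}, everything controlled by H_η lies in B^Ω(ε_{Ω+1}). It places the heights of
premises in OT, so that their collapses can index terms. -/
theorem mem_OT_of_mem_Hop {ξ : Ordinal.{0}} (hη : η ∈ OT) (h : ξ ∈ Hop η ∅)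
    (hξ : ξ < epsOm) : ξ ∈ OT :=
  ⟨mem_B_of_mem_Hop h hη.2, hξ⟩

theorem add_opow_mem_OT (hη : η ∈ OT) (hα : α ∈ OT) : η + ω ^ α ∈ OT :=
  add_mem_OT hη (opow_mem_OT hα)

end Stage

/-! ### Collapsing -/

/-- All formulas of `Γ` belong to `Π^E`. -/
def PiCtx (Γ : Finset Formula) : Prop := ∀ A ∈ Γ, A.IsPi

theorem PiCtx.cons {Γ : Finset Formula} (h : PiCtx Γ) {A : Formula} (hA : SigPi false A) :
    PiCtx (insert A Γ) := by
  intro B hB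
  obtain rfl | hB := Finset.mem_insert.1 hB
  · exact hA
  · exact h B hB

theorem PiCtx.tail {Γ : Finset Formula} {A : Formula} (h : PiCtx (insert A Γ)) : PiCtx Γ :=
  fun B hB => h B (Finset.mem_insert_of_mem hB)

theorem PiCtx.head {Γ : Finset Formula} {A : Formula} (h : PiCtx (insert A Γ)) :
    SigPi false A := h A (Finset.mem_insert_self _ _)

/-- The formula of `Δ`, if there is one, belongs to `Σ^E`. -/
def SigmaSucc (Δ : Option Formula) : Prop := ∀ A ∈ Δ, A.IsSigma

theorem SigmaSucc.some {A : Formula} (h : SigPi true A) : SigmaSucc (some A) := by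
  rintro _ ⟨⟩; exact h

theorem SigmaSucc.none : SigmaSucc none := nofun

theorem SigmaSucc.get {A : Formula} (h : SigmaSucc (Option.some A)) : SigPi true A := h A rfl

theorem sigPi_memT {pol : Bool} (s t : Term) : SigPi pol (memT s t) := .delta trivial

theorem sigPi_funT {pol : Bool} (p s t : Term) : SigPi pol (funT p s t) :=
  .delta (isDelta_funF _ _ _)

/-- Each left rule for ∧ uses one conjunct, so both are applied in turn while the conjunction stays
in the context; hence two extra steps. -/
theorem Prov.andL {ρ α : Ordinal.{0}} {H : Op} (hH : H.Closed) {Γ : Finset Formula}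
    {Δ : Option Formula} {A C : Formula} (h : Prov ρ H α (insert A (insert C Γ)) Δ) :
    Prov ρ H (α + 1 + 1) (insert (.and A C) Γ) Δ := by
  have h₁ : α + 1 ∈ H ∅ := hH.add h.height_mem (hH.one _)
  have h' : Prov ρ H α (insert A (insert C (insert (.and A C) Γ))) Δ :=
    h.weaken le_rfl (fun _ => subset_rfl) le_rfl h.height_mem
      (Finset.insert_subset_insert _ (Finset.insert_subset_insert _ (Finset.subset_insert _ _)))
  exact .of_mem (P := .and A C) (by simp) (.andL₂ (hH.add h₁ (hH.one _)) (lt_add_one _)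
    (.of_mem (P := .and A C) (by simp) (.andL₁ h₁ (lt_add_one _) h')))

/-- Cut with a `Δ₀` formula whose terms are `𝔼_β` and terms with declared levels. -/
theorem Prov.cut_isDelta {θ α₀ α₁ α₂ : Ordinal.{0}} {H : Op} (hH : H.Closed)
    {Γ : Finset Formula} {Δ : Option Formula} {A : Formula} {S : Set Term} {β : Idx}
    {b : Term → Idx} (hθ : psi θ ∈ H ∅) (h₀ : α₀ < psi θ) (h₁ : α₁ < psi θ) (h₂ : α₂ < psi θ)
    (hA : A.IsDelta) (hS : ∀ s ∈ A.params, s = .E β ∨ s ∈ S)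
    (hβ : (β : Ordinal.{0}) ∈ H ∅) (hβθ : (β : Ordinal.{0}) < psi θ)
    (hb : ∀ s ∈ S, (b s : Ordinal.{0}) ∈ H ∅ ∧ (b s : Ordinal.{0}) < psi θ)
    (hα₂ : α₂ ∈ H ∅)
    (p : Prov (psi θ) H α₀ (insert A Γ) Δ) (q : Prov (psi θ) H α₁ Γ (some A))
    (r : ∀ s ∈ S, Prov (psi θ) H α₂ Γ (some (memT s (.E (b s))))) :
    Prov (psi θ) H (psi θ) Γ Δ := by
  classical
  -- The assignment `b` promises nothing about 𝔼_β outside `S`, so 𝔼_β is redeclared at level β + 1,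
  -- still below ψ_Ω(θ).
  refine .cut (b := fun s => if s = .E β then β.succ else b s) hθ h₀ h₁ h₂
    (hA.rank_lt (omega0_lt_psi θ) (isPrincipal_add_psi θ) fun s hs => ?_) (fun s hs => ?_) p q
    (fun s hs => ?_)
  · split_ifs with he
    · exact psi_add_one_lt hβθ
    · exact (hb s ((hS s hs).resolve_left he)).2
  · split_ifs with he
    · exact hH.add hβ (hH.one _)
    · exact (hb s ((hS s hs).resolve_left he)).1
  · split_ifs with he
    · rw [he]; exact .E_mem_E β.lt_succ hα₂
    · exact r s ((hS s hs).resolve_left he)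

theorem Prov.bound_succ {ρ α : Ordinal.{0}} {H : Op} {Γ : Finset Formula} {A : Formula}
    {β : Idx} (hρ : (β : Ordinal.{0}) + 1 < ρ) (hp : Prov ρ H α Γ (some A)) (hH : H.Closed)
    (hβ : (β : Ordinal.{0}) ∈ H ∅) (hle : α ≤ β) (hA : A.IsSigma) :
    Prov ρ H α Γ (some (A.rel (.cst (.E β)))) :=
  hp.bound hρ hH hβ hle (fun B hB => ⟨B, hB, .refl⟩) (.some (Or.inr ⟨hA, rfl⟩))

theorem Prov.bound_ante {ρ α : Ordinal.{0}} {H : Op} {Γ : Finset Formula} {A : Formula}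
    {Δ : Option Formula} {β : Idx} (hρ : (β : Ordinal.{0}) + 1 < ρ)
    (hp : Prov ρ H α (insert A Γ) Δ) (hH : H.Closed)
    (hβ : (β : Ordinal.{0}) ∈ H ∅) (hle : α ≤ β) (hA : A.IsPi) :
    Prov ρ H α (insert (A.rel (.cst (.E β))) Γ) Δ := by
  refine hp.bound hρ hH hβ hle
    (BddL.cons (fun B hB => ⟨B, hB, .refl⟩) (Or.inr ⟨hA, rfl⟩)) ?_
  cases Δ with
  | none => exact .none
  | some B => exact .some .refl

/-- The statement of the collapsing theorem at height `α`. -/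
def Collapses (α : Ordinal.{0}) : Prop :=
  ∀ {η : Ordinal.{0}} {Γ : Finset Formula} {Δ : Option Formula}, η ∈ OT → α ∈ OT →
    η ∈ Hop η ∅ → PiCtx Γ → SigmaSucc Δ → Prov (Om + 1) (Hop η) α Γ Δ →
    Prov (psi (η + ω ^ α)) (Hop (η + ω ^ α)) (psi (η + ω ^ α)) Γ Δ

/-- Two successive applications of collapsing, followed by weakening. -/
theorem Collapses.two_step {η α α₀ α₁ : Ordinal.{0}} (IH : Collapses α₀) (hη : η ∈ OT)
    (hα₀ : α₀ ∈ OT) (hα₁ : α₁ ∈ OT) (hηH : η ∈ Hop η ∅) (h₀H : α₀ ∈ Hop η ∅)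
    (h₁H : α₁ ∈ Hop η ∅) (h₀ : α₀ < α) (h₁ : α₁ < α) {Γ : Finset Formula}
    {Δ : Option Formula} (hΓ : PiCtx Γ) (hΔ : SigmaSucc Δ)
    (p : Prov (Om + 1) (Hop (η + ω ^ α₁)) α₀ Γ Δ) :
    Prov (psi (η + ω ^ α)) (Hop (η + ω ^ α)) (psi (η + ω ^ α₁ + ω ^ α₀)) Γ Δ ∧
      psi (η + ω ^ α₁ + ω ^ α₀) < psi (η + ω ^ α) := by
  have hle : η ≤ η + ω ^ α₁ := le_self_add
  have hm := add_opow_mem_Hop hηH h₁H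
  have hm' := Hop_mono hle _ hm
  have hlt : η + ω ^ α₁ + ω ^ α₀ < η + ω ^ α := add_opow_add_opow_lt h₀ h₁
  have hm₂ : η + ω ^ α₁ + ω ^ α₀ ∈ Hop η ∅ := fun β hX hβ =>
    B_add (hm β hX hβ) (B_opow (h₀H β hX hβ))
  have hd := IH (add_opow_mem_OT hη hα₁) hα₀ hm' hΓ hΔ p
  exact ⟨hd.weaken (psi_mono hlt.le) (Hop_mono hlt.le) le_rfl (Hop_mono hlt.le _ hd.height_mem)
    subset_rfl, psi_lt_psi hlt (mem_B_of_mem_Hop hm₂ (lt_add_opow η α))⟩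

section CutCase

variable {η α α₀ α₁ α₂ : Ordinal.{0}} {Γ : Finset Formula} {Δ : Option Formula}
  {F : Fml Term true 1} {b : Term → Idx}

/-- The collapsing step for a cut with `∃x F(x)`. -/
theorem collapse_cut_ex (IH : ∀ α' < α, Collapses α') (hη : η ∈ OT) (hα : α ∈ OT)
    (hηH : η ∈ Hop η ∅) (hαH : α ∈ Hop η ∅) (hΓ : PiCtx Γ) (hΔ : SigmaSucc Δ)
    (h₀ : α₀ < α) (h₁ : α₁ < α) (h₂ : α₂ < psi (η + ω ^ α)) (hF : F.IsDelta)
    (hα₂ : α₂ ∈ Hop (η + ω ^ α) ∅)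
    (hb : ∀ s ∈ F.params, (b s : Ordinal.{0}) ∈ Hop (η + ω ^ α) ∅ ∧
      (b s : Ordinal.{0}) < psi (η + ω ^ α))
    (p : Prov (Om + 1) (Hop η) α₀ (insert (.ex rfl F) Γ) Δ)
    (q : Prov (Om + 1) (Hop η) α₁ Γ (some (.ex rfl F)))
    (r : ∀ s ∈ F.params, Prov (psi (η + ω ^ α)) (Hop (η + ω ^ α)) α₂ Γ
      (some (memT s (.E (b s))))) :
    Prov (psi (η + ω ^ α)) (Hop (η + ω ^ α)) (psi (η + ω ^ α)) Γ Δ := by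
  have hα₀OT := mem_OT_of_mem_Hop hη p.height_mem (h₀.trans hα.2)
  have hα₁OT := mem_OT_of_mem_Hop hη q.height_mem (h₁.trans hα.2)
  have hθ₁ := add_opow_mem_Hop hηH q.height_mem
  have hlt : η + ω ^ α₁ < η + ω ^ α := add_opow_lt h₁
  have hψ : psi (η + ω ^ α₁) < psi (η + ω ^ α) :=
    psi_lt_psi hlt (mem_B_of_mem_Hop hθ₁ (lt_add_opow η α))
  have hψ₁ := psi_mem_Hop (Hop_mono le_self_add _ hθ₁)
  have hψ' := Hop_mono hlt.le _ hψ₁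
  have hH := closed_Hop (η + ω ^ α)
  have hθ := psi_mem_Hop (Hop_mono le_self_add _ (add_opow_mem_Hop hηH hαH))
  set β : Idx := psiIdx (η + ω ^ α₁) (add_opow_mem_OT hη hα₁OT)
  have hβ1 : (β : Ordinal.{0}) + 1 < psi (η + ω ^ α) := psi_add_one_lt hψ
  have hsig : Fml.IsSigma (.ex rfl F : Formula) := .ex (.delta hF)
  -- The existential formula is Σ^E, so this premise collapses as it stands, and β is exactly the
  -- resulting height. As F is Δ₀, relativisation affects only the outer quantifier.
  have hq : Prov (psi (η + ω ^ α)) (Hop (η + ω ^ α)) (psi (η + ω ^ α₁)) Γ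
      (some (.bex (.cst (.E β)) F)) := by
    have h := ((IH α₁ h₁ hη hα₁OT hηH hΓ (.some hsig) q).weaken (psi_mono hlt.le)
      (Hop_mono hlt.le) le_rfl hψ' subset_rfl).bound_succ (β := β) hβ1 hH hψ' le_rfl hsig
    simpa only [Fml.rel, Arg.shift, hF.rel_eq] using h
  -- An existential antecedent is not Π^E, but its instances at terms of level β are. Since
  -- H_{η+ω^{α₁}} contains β, the inverted derivations can be collapsed over η+ω^{α₁}.
  have hp : ∀ s : Term, _ := fun s => Collapses.two_step (IH α₀ h₀) hη hα₀OT hα₁OT hηH p.height_mem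
    q.height_mem h₀ h₁ ((hΓ.cons (SigPi.inst (.delta hF) s)).cons (sigPi_memT s (.E β))) hΔ
    (p.exL_inv (Hop_mono le_self_add) β (Hop_adj_subset le_self_add hψ₁) s)
  set ψ₂ := psi (η + ω ^ α₁ + ω ^ α₀)
  -- The estimate does not depend on the term; 𝔼_β is an arbitrary choice.
  have hψ₂ : ψ₂ < psi (η + ω ^ α) := (hp (.E β)).2
  have hm := Op.max_mem (H := Hop (η + ω ^ α)) hψ' (hp (.E β)).1.height_mem
  refine .cut_isDelta (β := β) (S := F.params) hH hθ
    (psi_add_natCast_lt (max_lt hψ hψ₂) 3) hψ h₂ (A := .bex (.cst (.E β)) F) hF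
    (fun s hs => ?_) hψ' hψ hb hα₂ ?_ hq r
  · obtain h | h := hs
    · cases h; exact Or.inl rfl
    · exact Or.inr h
  -- The height max + 3 exceeds both ψ₂ + 2, reached after forming the conjunction, and the declared
  -- level β + 1 of 𝔼_β.
  · refine .bexL (β := β.succ) (α₁ := 0) (hH.add hm (hH.natCast _ 3)) ?_ ?_
      (hH.add hψ' (hH.one _)) ?_ (fun s => (hp s).1.andL hH) (.E_mem_E β.lt_succ (hH.zero _))
    · rw [add_assoc]
      exact (add_lt_add_right (by norm_num : (1 + 1 : Ordinal.{0}) < (3 : ℕ)) _).trans_le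
        (add_le_add_left (le_max_right _ _) _)
    · exact lt_of_lt_of_le (by norm_num) (le_add_self : ((3 : ℕ) : Ordinal.{0}) ≤ _)
    · exact (add_lt_add_right (by norm_num : (1 : Ordinal.{0}) < (3 : ℕ)) _).trans_le
        (add_le_add_left (le_max_left _ _) _)

/-- The collapsing step for a cut with `∀x F(x)`. -/
theorem collapse_cut_all (IH : ∀ α' < α, Collapses α') (hη : η ∈ OT) (hα : α ∈ OT)
    (hηH : η ∈ Hop η ∅) (hαH : α ∈ Hop η ∅) (hΓ : PiCtx Γ) (hΔ : SigmaSucc Δ)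
    (h₀ : α₀ < α) (h₁ : α₁ < α) (h₂ : α₂ < psi (η + ω ^ α)) (hF : F.IsDelta)
    (hα₂ : α₂ ∈ Hop (η + ω ^ α) ∅)
    (hb : ∀ s ∈ F.params, (b s : Ordinal.{0}) ∈ Hop (η + ω ^ α) ∅ ∧
      (b s : Ordinal.{0}) < psi (η + ω ^ α))
    (p : Prov (Om + 1) (Hop η) α₀ (insert (.all rfl F) Γ) Δ)
    (q : Prov (Om + 1) (Hop η) α₁ Γ (some (.all rfl F)))
    (r : ∀ s ∈ F.params, Prov (psi (η + ω ^ α)) (Hop (η + ω ^ α)) α₂ Γ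
      (some (memT s (.E (b s))))) :
    Prov (psi (η + ω ^ α)) (Hop (η + ω ^ α)) (psi (η + ω ^ α)) Γ Δ := by
  have hα₀OT := mem_OT_of_mem_Hop hη p.height_mem (h₀.trans hα.2)
  have hα₁OT := mem_OT_of_mem_Hop hη q.height_mem (h₁.trans hα.2)
  have hθ₀ := add_opow_mem_Hop hηH p.height_mem
  have hlt : η + ω ^ α₀ < η + ω ^ α := add_opow_lt h₀
  have hψ : psi (η + ω ^ α₀) < psi (η + ω ^ α) :=
    psi_lt_psi hlt (mem_B_of_mem_Hop hθ₀ (lt_add_opow η α))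
  have hψ₀ := psi_mem_Hop (Hop_mono le_self_add _ hθ₀)
  have hψ' := Hop_mono hlt.le _ hψ₀
  have hH := closed_Hop (η + ω ^ α)
  have hθ := psi_mem_Hop (Hop_mono le_self_add _ (add_opow_mem_Hop hηH hαH))
  set β : Idx := psiIdx (η + ω ^ α₀) (add_opow_mem_OT hη hα₀OT)
  have hβ1 : (β : Ordinal.{0}) + 1 < psi (η + ω ^ α) := psi_add_one_lt hψ
  have hpi : Fml.IsPi (.all rfl F : Formula) := .all (.delta hF)
  -- The roles are exchanged: the universal formula is Π^E in the antecedent, so this premise is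
  -- collapsed and bounded, and the other one is inverted.
  have hp : Prov (psi (η + ω ^ α)) (Hop (η + ω ^ α)) (psi (η + ω ^ α₀))
      (insert (.ball (.cst (.E β)) F) Γ) Δ := by
    have h := ((IH α₀ h₀ hη hα₀OT hηH (hΓ.cons hpi) hΔ p).weaken (psi_mono hlt.le)
      (Hop_mono hlt.le) le_rfl hψ' subset_rfl).bound_ante (β := β) hβ1 hH hψ' le_rfl hpi
    simpa only [Fml.rel, Arg.shift, hF.rel_eq] using h
  have hq : ∀ s : Term, _ := fun s => Collapses.two_step (IH α₁ h₁) hη hα₁OT hα₀OT hηH q.height_mem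
    p.height_mem h₁ h₀ (hΓ.cons (sigPi_memT s (.E β))) (.some (SigPi.inst (.delta hF) s))
    (q.allR_inv (Hop_mono le_self_add) β (Hop_adj_subset le_self_add hψ₀) s)
  set ψ₂ := psi (η + ω ^ α₀ + ω ^ α₁)
  have hψ₂ : ψ₂ < psi (η + ω ^ α) := (hq (.E β)).2
  have hψ₂' := (hq (.E β)).1.height_mem
  have hm := Op.max_mem (H := Hop (η + ω ^ α)) hψ' hψ₂'
  refine .cut_isDelta (β := β) (S := F.params) hH hθ hψ
    (psi_add_natCast_lt (max_lt hψ hψ₂) 3) h₂ (A := .ball (.cst (.E β)) F) hF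
    (fun s hs => ?_) hψ' hψ hb hα₂ hp ?_ r
  · obtain h | h := hs
    · cases h; exact Or.inl rfl
    · exact Or.inr h
  · refine .ballR (β := β.succ) (α₀ := ψ₂ + 1) (α₁ := 0) (hH.add hm (hH.natCast _ 3)) ?_ ?_
      (hH.add hψ' (hH.one _)) ?_
      (fun s => .impR (hH.add hψ₂' (hH.one _)) (lt_add_one _) (hq s).1)
      (.E_mem_E β.lt_succ (hH.zero _))
    · exact (add_lt_add_right (by norm_num : (1 : Ordinal.{0}) < (3 : ℕ)) _).trans_le
        (add_le_add_left (le_max_right _ _) _)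
    · exact lt_of_lt_of_le (by norm_num) (le_add_self : ((3 : ℕ) : Ordinal.{0}) ≤ _)
    · exact (add_lt_add_right (by norm_num : (1 : Ordinal.{0}) < (3 : ℕ)) _).trans_le
        (add_le_add_left (le_max_left _ _) _)

end CutCase

/-- Heights collapse by `hψ` and levels by `hidx`, so each rule other than reflection and cut is
reapplied to its collapsed premises or excluded by the formula classes. -/
theorem collapses (α : Ordinal.{0}) : Collapses α := by
  induction α using WellFoundedLT.induction with
  | _ α IH
  intro η Γ Δ hη hα hηH hΓ hΔ h
  have hαH := h.height_mem
  have hθ := psi_mem_Hop (Hop_mono le_self_add _ (add_opow_mem_Hop hηH hαH))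
  have hH := closed_Hop (η + ω ^ α)
  have hmono : ∀ X, Hop η X ⊆ Hop (η + ω ^ α) X := Hop_mono le_self_add
  have hmem : ∀ {ξ}, ξ ∈ Hop η ∅ → ξ ∈ Hop (η + ω ^ α) ∅ := fun h => hmono _ h
  have hψ : ∀ {α₀}, α₀ < α → α₀ ∈ Hop η ∅ → psi (η + ω ^ α₀) < psi (η + ω ^ α) := fun h h' =>
    psi_lt_psi (add_opow_lt h) (mem_B_of_mem_Hop (add_opow_mem_Hop hηH h') (lt_add_opow η α))
  -- Side conditions comparing a level with the old height say nothing about the collapsed one;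
  -- control of the level by H_η supplies the new bound.
  have hidx : ∀ {γ : Idx}, (γ : Ordinal.{0}) ∈ Hop η ∅ → (γ : Ordinal.{0}) < psi (η + ω ^ α) :=
    fun {γ} h => lt_psi_of_mem_B (mem_B_of_mem_Hop h (lt_add_opow η α)) γ.2.2
  have ih : ∀ {α₀ : Ordinal.{0}} {Γ : Finset Formula} {Δ : Option Formula}, α₀ < α →
      PiCtx Γ → SigmaSucc Δ → Prov (Om + 1) (Hop η) α₀ Γ Δ →
      Prov (psi (η + ω ^ α)) (Hop (η + ω ^ α)) (psi (η + ω ^ α₀)) Γ Δ := by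
    intro α₀ Γ Δ h₀ hΓ hΔ p
    have hle := (add_opow_lt (η := η) h₀).le
    have hd := IH α₀ h₀ hη (mem_OT_of_mem_Hop hη p.height_mem (h₀.trans hα.2)) hηH hΓ hΔ p
    exact hd.weaken (psi_mono hle) (Hop_mono hle) le_rfl (Hop_mono hle _ hd.height_mem) subset_rfl
  have ihm : ∀ {α₀ : Ordinal.{0}} {Γ : Finset Formula} {s t : Term}, α₀ < α → PiCtx Γ →
      Prov (Om + 1) (Hop η) α₀ Γ (some (memT s t)) →
      Prov (psi (η + ω ^ α)) (Hop (η + ω ^ α)) (psi (η + ω ^ α₀)) Γ (some (memT s t)) :=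
    fun h₀ hΓ p => ih h₀ hΓ (.some (sigPi_memT _ _)) p
  have h3 : ∀ {x : Ordinal.{0}}, x < psi (η + ω ^ α) → x + 3 < psi (η + ω ^ α) := fun h => by
    simpa using psi_add_natCast_lt h 3
  cases h with
  | ax _ h => exact .ax hθ h
  | andL₁ _ h₀ p =>
    exact .andL₁ hθ (hψ h₀ p.height_mem) (ih h₀ (hΓ.tail.cons (sigPi_and.1 hΓ.head).1) hΔ p)
  | andL₂ _ h₀ p =>
    exact .andL₂ hθ (hψ h₀ p.height_mem) (ih h₀ (hΓ.tail.cons (sigPi_and.1 hΓ.head).2) hΔ p)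
  | andR _ h₀ p q =>
    exact .andR hθ (hψ h₀ p.height_mem) (ih h₀ hΓ (.some (sigPi_and.1 hΔ.get).1) p)
      (ih h₀ hΓ (.some (sigPi_and.1 hΔ.get).2) q)
  | orL _ h₀ p q =>
    exact .orL hθ (hψ h₀ p.height_mem) (ih h₀ (hΓ.tail.cons (sigPi_or.1 hΓ.head).1) hΔ p)
      (ih h₀ (hΓ.tail.cons (sigPi_or.1 hΓ.head).2) hΔ q)
  | orR₁ _ h₀ p =>
    exact .orR₁ hθ (hψ h₀ p.height_mem) (ih h₀ hΓ (.some (sigPi_or.1 hΔ.get).1) p)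
  | orR₂ _ h₀ p =>
    exact .orR₂ hθ (hψ h₀ p.height_mem) (ih h₀ hΓ (.some (sigPi_or.1 hΔ.get).2) p)
  | negL _ h₀ p =>
    exact .negL hθ (hψ h₀ p.height_mem) (ih h₀ hΓ.tail (.some (sigPi_neg.1 hΓ.head)) p)
  | negR _ h₀ p =>
    exact .negR hθ (hψ h₀ p.height_mem) (ih h₀ (hΓ.cons (sigPi_neg.1 hΔ.get)) .none p)
  | bot _ h₀ p => exact .bot hθ (hψ h₀ p.height_mem) (ih h₀ hΓ .none p)
  | impL _ h₀ p q =>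
    exact .impL hθ (hψ h₀ p.height_mem) (ih h₀ (hΓ.tail.cons (sigPi_imp.1 hΓ.head).2) hΔ p)
      (ih h₀ hΓ.tail (.some (sigPi_imp.1 hΓ.head).1) q)
  | impR _ h₀ p =>
    exact .impR hθ (hψ h₀ p.height_mem)
      (ih h₀ (hΓ.cons (sigPi_imp.1 hΔ.get).1) (.some (sigPi_imp.1 hΔ.get).2) p)
  | @lim _ _ Γ _ s γ a _ hγ hγH ha p =>
    -- As γ is countable and lies in B^Ω(η+1), it is below ψ_Ω(η+1), and so are all δ < γ. Thus δ
    -- already belongs to H_η(∅) and the premises need no enlarged operator.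
    have hlow : ∀ δ : Idx, δ < γ → (δ : Ordinal.{0}) ∈ Hop η ∅ := fun δ hδ =>
      mem_Hop_empty.2 (mem_B_of_lt_psi
        ((show (δ : Ordinal.{0}) < γ from hδ).trans
          (lt_psi_of_mem_B (mem_Hop_empty.1 hγH) γ.2.2)))
    have hp : ∀ δ : Idx, δ < γ →
        Prov (Om + 1) (Hop η) (a δ) (insert (memT s (.E δ)) Γ) Δ := fun δ hδ =>
      (p δ hδ).weaken le_rfl (Hop_adj_subset le_rfl (hlow δ hδ)) le_rfl
        (Hop_adj_subset le_rfl (hlow δ hδ) _ (p δ hδ).height_mem) subset_rfl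
    refine .lim (a := fun δ => psi (η + ω ^ a δ)) hθ hγ (hmem hγH)
      (fun δ hδ => hψ (ha δ hδ) (hp δ hδ).height_mem) fun δ hδ => ?_
    have hd := ih (ha δ hδ) (hΓ.tail.cons (sigPi_memT _ _)) hΔ (hp δ hδ)
    exact hd.weaken le_rfl (hH.subset_adj δ) le_rfl (hH.subset_adj δ _ hd.height_mem) subset_rfl
  | ballL _ h₀ h₁ h₂ hβ hγ hγα hγβ p q r =>
    exact .ballL hθ (hψ h₀ p.height_mem) (hψ h₁ q.height_mem) (hψ h₂ r.height_mem) (hmem hβ)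
      (hmem hγ) (hidx hγ) hγβ
      (ih h₀ (hΓ.tail.cons (.imp (sigPi_memT _ _) (SigPi.inst (sigPi_ball.1 hΓ.head) _))) hΔ p)
      (ihm h₁ hΓ.tail q) (ihm h₂ hΓ.tail r)
  | @ballR _ _ α₀ α₁ _ t A β _ h₀ h₁ hβ hβα p q =>
    -- All instances share one height, so any of them, here the one at `t`, shows that it is
    -- controlled.
    exact .ballR hθ (hψ h₀ (p t).height_mem) (hψ h₁ q.height_mem) (hmem hβ) (hidx hβ)
      (fun s => ih h₀ hΓ
        (.some (.imp (sigPi_memT _ _) (SigPi.inst (sigPi_ball.1 hΔ.get) _))) (p s))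
      (ihm h₁ hΓ q)
  | @bexL _ _ α₀ α₁ _ _ t A β _ h₀ h₁ hβ hβα p q =>
    exact .bexL hθ (hψ h₀ (p t).height_mem) (hψ h₁ q.height_mem) (hmem hβ) (hidx hβ)
      (fun s => ih h₀
        (hΓ.tail.cons (.and (sigPi_memT _ _) (SigPi.inst (sigPi_bex.1 hΓ.head) _))) hΔ (p s))
      (ihm h₁ hΓ.tail q)
  | bexR _ h₀ h₁ h₂ hβ hγ hγα hγβ p q r =>
    exact .bexR hθ (hψ h₀ p.height_mem) (hψ h₁ q.height_mem) (hψ h₂ r.height_mem) (hmem hβ)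
      (hmem hγ) (hidx hγ) hγβ
      (ih h₀ hΓ (.some (.and (sigPi_memT _ _) (SigPi.inst (sigPi_bex.1 hΔ.get) _))) p)
      (ihm h₁ hΓ q) (ihm h₂ hΓ r)
  | eballL _ h₀ h₁ h₂ h₃ hβ hγ hδ hδα hδm q₀ q₁ q₂ q₃ =>
    exact .eballL hθ (hψ h₀ q₀.height_mem) (hψ h₁ q₁.height_mem) (hψ h₂ q₂.height_mem)
      (hψ h₃ q₃.height_mem) (hmem hβ) (hmem hγ) (hmem hδ) (hidx hδ) hδm
      (ih h₀ (hΓ.tail.cons (.imp (sigPi_funT _ _ _) (SigPi.inst (sigPi_eball.1 hΓ.head) _)))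
        hΔ q₀)
      (ihm h₁ hΓ.tail q₁) (ihm h₂ hΓ.tail q₂) (ihm h₃ hΓ.tail q₃)
  | @eballR _ _ α₀ α₁ α₂ _ s t A β γ _ h₀ h₁ h₂ hβ hγ hm q₀ q₁ q₂ =>
    exact .eballR hθ (hψ h₀ (q₀ t).height_mem) (hψ h₁ q₁.height_mem) (hψ h₂ q₂.height_mem)
      (hmem hβ) (hmem hγ) (by simpa using (psi_add_natCast_lt (max_lt (hidx hβ) (hidx hγ)) 2).le)
      (fun p => ih h₀ hΓ
        (.some (.imp (sigPi_funT _ _ _) (SigPi.inst (sigPi_eball.1 hΔ.get) _))) (q₀ p))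
      (ihm h₁ hΓ q₁) (ihm h₂ hΓ q₂)
  | @ebexL _ _ α₀ α₁ α₂ _ _ s t A β γ _ h₀ h₁ h₂ hβ hγ hm q₀ q₁ q₂ =>
    exact .ebexL hθ (hψ h₀ (q₀ t).height_mem) (hψ h₁ q₁.height_mem) (hψ h₂ q₂.height_mem)
      (hmem hβ) (hmem hγ) (by simpa using (psi_add_natCast_lt (max_lt (hidx hβ) (hidx hγ)) 2).le)
      (fun p => ih h₀
        (hΓ.tail.cons (.and (sigPi_funT _ _ _) (SigPi.inst (sigPi_ebex.1 hΓ.head) _))) hΔ (q₀ p))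
      (ihm h₁ hΓ.tail q₁) (ihm h₂ hΓ.tail q₂)
  | ebexR _ h₀ h₁ h₂ h₃ hβ hγ hδ hδα hδm q₀ q₁ q₂ q₃ =>
    exact .ebexR hθ (hψ h₀ q₀.height_mem) (hψ h₁ q₁.height_mem) (hψ h₂ q₂.height_mem)
      (hψ h₃ q₃.height_mem) (hmem hβ) (hmem hγ) (hmem hδ) (hidx hδ) hδm
      (ih h₀ hΓ (.some (.and (sigPi_funT _ _ _) (SigPi.inst (sigPi_ebex.1 hΔ.get) _))) q₀)
      (ihm h₁ hΓ q₁) (ihm h₂ hΓ q₂) (ihm h₃ hΓ q₃)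
  | allL _ h₀ h₁ hβα hβ p q =>
    have h₀' := le_self_add.trans_lt h₀
    have h₁' := le_self_add.trans_lt h₁
    exact .allL hθ (h3 (hψ h₀' p.height_mem)) (h3 (hψ h₁' q.height_mem)) (hidx hβ) (hmem hβ)
      (ih h₀' (hΓ.tail.cons (SigPi.inst (sigPi_all.1 hΓ.head).2 _)) hΔ p) (ihm h₁' hΓ.tail q)
  | allR _ _ _ => exact absurd (sigPi_all.1 hΔ.get).1 (by decide)
  | exL _ _ _ => exact absurd (sigPi_ex.1 hΓ.head).1 (by decide)
  | exR _ h₀ h₁ hβα hβ p q =>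
    have h₀' := le_self_add.trans_lt h₀
    have h₁' := le_self_add.trans_lt h₁
    exact .exR hθ (h3 (hψ h₀' p.height_mem)) (h3 (hψ h₁' q.height_mem)) (hidx hβ) (hmem hβ)
      (ih h₀' hΓ (.some (SigPi.inst (sigPi_ex.1 hΔ.get).2 _)) p) (ihm h₁' hΓ q)
  | @ref _ _ α₀ _ A _ h₀ hΩ hA p =>
    have h₀' := le_self_add.trans_lt h₀
    have hlt := hψ h₀' p.height_mem
    have hd := ih h₀' hΓ (.some hA) p
    have hα₀OT := mem_OT_of_mem_Hop hη p.height_mem (h₀'.trans hα.2)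
    -- The collapsed height of the premise serves as the bound, and 𝔼_β, of level β + 1, as the
    -- reflecting set. Reflection disappears from the derivation.
    set β : Idx := psiIdx (η + ω ^ α₀) (add_opow_mem_OT hη hα₀OT)
    have hb := hd.bound_succ (β := β) (psi_add_one_lt hlt) hH hd.height_mem le_rfl hA
    rw [← Fml.shift_rel_inst] at hb
    exact .exR (β := β.succ) (α₁ := 0) hθ (h3 hlt) (h3 (psi_pos _)) (psi_add_one_lt hlt)
      (hH.add hd.height_mem (hH.one _)) hb (.E_mem_E β.lt_succ (hH.zero _))
  | @cut _ _ α₀ α₁ α₂ _ _ A b _ h₀ h₁ h₂ hr hb p q r =>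
    have hb' : ∀ s ∈ A.params, (b s : Ordinal.{0}) ∈ Hop (η + ω ^ α) ∅ ∧
        (b s : Ordinal.{0}) < psi (η + ω ^ α) := fun s hs => ⟨hmem (hb s hs), hidx (hb s hs)⟩
    have hr' : ∀ s ∈ A.params, Prov (psi (η + ω ^ α)) (Hop (η + ω ^ α)) (psi (η + ω ^ α₂)) Γ
        (some (memT s (.E (b s)))) := fun s hs => ihm h₂ hΓ (r s hs)
    -- the height `α₂` is controlled only if the cut formula contains terms
    obtain ⟨α₃, h₃, h₃H, hr₃⟩ : ∃ α₃, α₃ < psi (η + ω ^ α) ∧ α₃ ∈ Hop (η + ω ^ α) ∅ ∧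
        ∀ s ∈ A.params, Prov (psi (η + ω ^ α)) (Hop (η + ω ^ α)) α₃ Γ
          (some (memT s (.E (b s)))) := by
      by_cases hne : A.params.Nonempty
      · obtain ⟨s, hs⟩ := hne
        exact ⟨_, hψ h₂ (r s hs).height_mem, (hr' s hs).height_mem, hr'⟩
      · exact ⟨0, psi_pos _, hH.zero _, fun s hs => absurd ⟨s, hs⟩ hne⟩
    obtain hA | ⟨F, hF, rfl⟩ | ⟨F, hF, rfl⟩ := isDelta_or_of_rank_le (Order.lt_add_one_iff.1 hr)
    · exact .cut hθ (hψ h₀ p.height_mem) (hψ h₁ q.height_mem) h₃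
        (hA.rank_lt (omega0_lt_psi _) (isPrincipal_add_psi _) fun s hs => (hb' s hs).2)
        (fun s hs => (hb' s hs).1) (ih h₀ (hΓ.cons (.delta hA)) hΔ p)
        (ih h₁ hΓ (.some (.delta hA)) q) hr₃
    · exact collapse_cut_all IH hη hα hηH hαH hΓ hΔ h₀ h₁ h₃ hF h₃H hb' p q hr₃
    · exact collapse_cut_ex IH hη hα hηH hαH hΓ hΔ h₀ h₁ h₃ hF h₃H hb' p q hr₃

end IRSE

open IRSE
theorem mainTheorem7 (η α : Ordinal.{0}) (hηOT : η ∈ IRSE.OT) (hαOT : α ∈ IRSE.OT)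
    (hη : η ∈ IRSE.Hop η ∅)
    (Γ : Finset IRSE.Formula) (Δ : Option IRSE.Formula)
    (hΓ : ∀ A ∈ Γ, A.IsPi) (hΔ : ∀ A ∈ Δ, A.IsSigma)
    (h : IRSE.Prov (IRSE.Om + 1) (IRSE.Hop η) α Γ Δ) :
    IRSE.psi (η + Ordinal.omega0 ^ α) < IRSE.Om ∧
      IRSE.Prov (IRSE.psi (η + Ordinal.omega0 ^ α)) (IRSE.Hop (η + Ordinal.omega0 ^ α))
        (IRSE.psi (η + Ordinal.omega0 ^ α)) Γ Δ :=
  ⟨psi_lt_Om _, collapses α hηOT hαOT hη hΓ hΔ h⟩
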